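/- **Setting.** Let $G$ be a second countable, locally compact Hausdorff group (for example a Lie group with countably many components) acting continuously on an oriented topological $d$-manifold $X$ without boundary. Let $\mu:G\to\{\pm1\}$ be a continuous homomorphism ($-1$ on anti-unitary elements) and $\mathrm{or}:G\to\{\pm1\}$ the sign with which $G$ acts on the orientation of $X$. Let $X$ carry a locally finite regular CW decomposition such that every $g\in G$ maps $k$-cells to $k$-cells, an element that preserves a cell fixes it pointwise, and the isotropy group $G_\sigma$ of every cell is compact. Let $\Lambda$ be a $G$-set with an equivariant finite-to-one map $\Lambda\to X$ (e.g. the inclusion of an invariant subset) that takes values in the vertices of $X$. **Chains.** For $A\in\{\mathrm U(1)=\mathbb R/\mathbb Z,\ \mathbb R,\ \mathbb Z\}$, with $G$ acting on $A$ through the sign $\mu$, let $C_k(X,A)$ be the group of possibly infinite cellular $k$-chains, let $\mathcal C^p(G,M)$ denote measurable group $p$-cochains, and put $C^G_r(X,A)=\bigoplus_{k}\mathcal C^{k-r}(G,C_k(X,A))$ with total boundary $D=\partial+(-1)^r\delta$. Its homology is $H^G_r(X,A)$; the groups of $\Lambda$ (regarded as a complex with $0$-cells only) and of the $0$-skeleton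 $X_0$ are defined in the same way. An *anomalous texture* is a class $[\omega]\in H^G_{-2}(\Lambda,\mathrm U(1))$. **Dual cells.** Let $X^\vee$ be the dual cell complex: its $q$-cells $\sigma^\vee$ are dual to the $(d-q)$-cells $\sigma$ of $X$, with $[\tau^\vee:\sigma^\vee]=[\sigma:\tau]$. Let $X^\vee_{d-1}$ be its $(d-1)$-skeleton. Equivariant cohomology $H^n_G$ (absolute or relative) is the cohomology of $\bigoplus_{p+q=n}\mathcal C^p(G,C^q(\cdot,A))$ with $\Delta=\delta+(-1)^n d$. By $\mathbb Z^{\mathrm{or}}$ we mean $\mathbb Z$ with $G$ acting through $\mu\cdot\mathrm{or}$. **Defect networks.** An *invertible-substrate in-cohomology defect network* on $X$, specified on all cells of positive dimension and possibly anomalous at the vertices, is a cocycle $\nu\in Z^{d+2}_G(X^\vee_{d-1},\mathbb Z^{\mathrm{or}})$. Its *anomaly* is $s_1(\nu)\in H^{d+3}_G(X^\vee,X^\vee_{d-1};\mathbb Z^{\mathrm{or}})$, where $s_1$ is the connecting map of the pair (extend $\nu$ by zero and apply $\Delta$). The network *cancels* the texture $[\omega]$ if $s_1(\nu)+\mathrm{PL}(\beta([\omega]_0))=0$,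 where $[\omega]_0\in H^G_{-2}(X_0,\mathrm U(1))$ is the image of $[\omega]$, $\beta:H^G_{-2}(X_0,\mathrm U(1))\to H^G_{-3}(X_0,\mathbb Z)$ is the Bockstein, and $\mathrm{PL}:H^G_{-3}(X_0,\mathbb Z)\to H^{d+3}_G(X^\vee,X^\vee_{d-1};\mathbb Z^{\mathrm{or}})$ is Poincaré–Lefschetz duality, induced by $\sigma\mapsto\sigma^\vee$. **Theorem.** An anomalous texture $[\omega]\in H^G_{-2}(\Lambda,\mathrm U(1))$ is cancelled by some invertible-substrate in-cohomology defect network on $X$ if and only if its image under the map $H^G_{-2}(\Lambda,\mathrm U(1))\to H^G_{-2}(X,\mathrm U(1))$ induced by $\Lambda\to X$ is trivial. -/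

import Mathlib

noncomputable section

namespace CrystalAnomaly

open Topology Set

universe u v w

/-! ## Oriented cell complexes with a group action -/

/-- The cellular data of an oriented cell complex with an action of `G` that permutes the cells:
dimensions, incidence numbers `inc σ τ = [σ : τ]` (the coefficient of `τ` in `∂σ`), and the sign
`sgn g σ` with which `g` carries the oriented cell `σ` to the oriented cell `g • σ`. -/
structure GCellComplex (G : Type v) [Group G] where
  Cell : Type u
  [action : MulAction G Cell]
  dim : Cell → ℕ
  inc : Cell → Cell → ℤ
  sgn : G → Cell → ℤˣ
  dim_smul : ∀ (g : G) σ, dim (g • σ) = dim σ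
  dim_of_inc : ∀ σ τ, inc σ τ ≠ 0 → dim σ = dim τ + 1
  finite_faces : ∀ σ, {τ | inc σ τ ≠ 0}.Finite
  finite_cofaces : ∀ τ, {σ | inc σ τ ≠ 0}.Finite
  inc_inc : ∀ σ ρ, ∑ᶠ τ, inc σ τ * inc τ ρ = 0
  sgn_mul : ∀ (g h : G) σ, sgn (g * h) σ = sgn g (h • σ) * sgn h σ
  inc_smul : ∀ (g : G) σ τ, inc (g • σ) (g • τ) = ((sgn g σ * sgn g τ : ℤˣ) : ℤ) * inc σ τ

attribute [instance] GCellComplex.action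

namespace GCellComplex

variable {G : Type v} [Group G] (K : GCellComplex.{u, v} G)

/-! ## The double complex -/

/-- All bidegrees of the double complex at once: a homogeneous group `p`-cochain (for every `p`)
with values in the formal, possibly infinite, linear combinations of cells with coefficients in
`A`. A linear combination of cells is recorded by its coefficients. The same data is a group
`p`-cochain with values in the cellular cochains. -/
abbrev Total (A : Type w) : Type (max u v w) := (p : ℕ) → (Fin (p + 1) → G) → K.Cell → A

section operators

variable (A : Type w) [AddCommGroup A]

/-- The group coboundary of homogeneous cochains,
`(δβ)(g₀, …, g_{p+1}) = ∑ᵢ (-1)ⁱ β(g₀, …, ĝᵢ, …, g_{p+1})`. -/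
def groupD : K.Total A →+ K.Total A where
  toFun β := fun p => match p with
    | 0 => fun _ _ => 0
    | p + 1 => fun g σ => ∑ i : Fin (p + 2), (-1 : ℤ) ^ (i : ℕ) • β p (g ∘ i.succAbove) σ
  map_zero' := by
    funext p g σ
    cases p <;> simp
  map_add' a b := by
    funext p g σ
    cases p <;> simp [Finset.sum_add_distrib]

/-- The cellular boundary, `(∂β)(τ) = ∑_σ [σ : τ] β(σ)`. -/
def bdry : K.Total A →+ K.Total A where
  toFun β := fun p g τ => ∑ᶠ σ, K.inc σ τ • β p g σ
  map_zero' := by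
    funext p g τ
    simp
  map_add' a b := by
    funext p g τ
    simp only [Pi.add_apply, smul_add]
    refine finsum_add_distrib ?_ ?_ <;>
    · refine (K.finite_cofaces τ).subset fun σ h hσ => h ?_
      simp [hσ]

/-- The cellular coboundary, `(dα)(σ) = ∑_τ [σ : τ] α(τ)`. -/
def cobdry : K.Total A →+ K.Total A where
  toFun α := fun p g σ => ∑ᶠ τ, K.inc σ τ • α p g τ
  map_zero' := by
    funext p g τ
    simp
  map_add' a b := by
    funext p g σ
    simp only [Pi.add_apply, smul_add]
    refine finsum_add_distrib ?_ ?_ <;>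
    · refine (K.finite_faces σ).subset fun τ h hτ => h ?_
      simp [hτ]

/-- The total boundary `D = ∂ + (-1)^r δ` on equivariant `r`-chains. -/
def chainD (r : ℤ) : K.Total A →+ K.Total A :=
  K.bdry A + (r.negOnePow : ℤ) • K.groupD A

/-- The total coboundary `Δ = δ + (-1)^n d` on equivariant `n`-cochains. -/
def cochainD (n : ℤ) : K.Total A →+ K.Total A :=
  K.groupD A + (n.negOnePow : ℤ) • K.cobdry A

end operators

section groups

variable [MeasurableSpace G]
variable (χ : G →* ℤˣ) (A : Type w) [AddCommGroup A] [MeasurableSpace A]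
variable [MeasurableAdd₂ A] [MeasurableNeg A]

/-- The measurable homogeneous cochains: `β(h g₀, …, h g_p) = h · β(g₀, …, g_p)`, where `h` acts on
a linear combination of oriented cells by moving the cells with their orientations, and on the
coefficients through the sign `χ h`. -/
def equivariant : AddSubgroup (K.Total A) where
  carrier := {β | (∀ p σ, Measurable fun g : Fin (p + 1) → G => β p g σ) ∧
    ∀ p h (g : Fin (p + 1) → G) σ,
      β p (fun i => h * g i) (h • σ) = (χ h * K.sgn h σ) • β p g σ}
  zero_mem' := ⟨fun _ _ => measurable_const, fun _ _ _ _ => by simp⟩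
  add_mem' ha hb := ⟨fun p σ => (ha.1 p σ).add (hb.1 p σ), fun p h g σ => by
    simp only [Pi.add_apply, smul_add, ha.2 p h g σ, hb.2 p h g σ]⟩
  neg_mem' ha := ⟨fun p σ => (ha.1 p σ).neg, fun p h g σ => by
    simp only [Pi.neg_apply, smul_neg, ha.2 p h g σ]⟩

/-- The elements of the double complex whose components outside the bidegrees and cells selected
by `P` vanish. -/
def supported (P : ℕ → K.Cell → Prop) : AddSubgroup (K.Total A) where
  carrier := {β | ∀ p g σ, β p g σ ≠ 0 → P p σ}
  zero_mem' := fun _ _ _ h => absurd rfl h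
  add_mem' {a b} ha hb p g σ h := by
    by_contra hP
    have h1 : a p g σ = 0 := by_contra fun h' => hP (ha p g σ h')
    have h2 : b p g σ = 0 := by_contra fun h' => hP (hb p g σ h')
    exact h (by simp [h1, h2])
  neg_mem' {a} ha p g σ h := ha p g σ fun h' => h (by simp [h'])

/-- `C_r^G(L, A) = ⨁_k C^{k-r}(G, C_k(L, A))`, where `L` is a set of cells. -/
def chains (r : ℤ) (L : Set K.Cell) : AddSubgroup (K.Total A) :=
  K.equivariant χ A ⊓ K.supported A fun p σ => (K.dim σ : ℤ) - p = r ∧ σ ∈ L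

/-- Equivariant cycles `Z_r^G(L, A)` of a subcomplex `L`. -/
def cycles (r : ℤ) (L : Set K.Cell) : AddSubgroup (K.Total A) :=
  K.chains χ A r L ⊓ (K.chainD A r).ker

/-- Equivariant boundaries `B_r^G(L, A)` of a subcomplex `L`. -/
def boundaries (r : ℤ) (L : Set K.Cell) : AddSubgroup (K.Total A) :=
  (K.chains χ A (r + 1) L).map (K.chainD A (r + 1))

/-- Equivariant homology `H_r^G(L, A) = Z_r^G(L, A) / B_r^G(L, A)` of a subcomplex `L`. The group
`G` acts on the coefficients through `χ`. -/
abbrev Homology (r : ℤ) (L : Set K.Cell) : Type (max u v w) :=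
  K.cycles χ A r L ⧸ (K.boundaries χ A r L).addSubgroupOf (K.cycles χ A r L)

/-- The equivariant `n`-cochains (`n = p + q`) supported on a set of cells: for `L = Y` these are
the cochains of a subcomplex `Y`, for `L = Yᶜ` the cochains relative to `Y`. -/
def cochains (n : ℤ) (L : Set K.Cell) : AddSubgroup (K.Total A) :=
  K.equivariant χ A ⊓ K.supported A fun p σ => (K.dim σ : ℤ) + p = n ∧ σ ∈ L

/-- Relative equivariant cocycles `Z^n_G(K, Y; A)`. -/
def relCocycles (n : ℤ) (Y : Set K.Cell) : AddSubgroup (K.Total A) :=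
  K.cochains χ A n Yᶜ ⊓ (K.cochainD A n).ker

/-- Relative equivariant coboundaries `B^n_G(K, Y; A)`. -/
def relCoboundaries (n : ℤ) (Y : Set K.Cell) : AddSubgroup (K.Total A) :=
  (K.cochains χ A (n - 1) Yᶜ).map (K.cochainD A (n - 1))

/-- Relative equivariant cohomology `H^n_G(K, Y; A)`. -/
abbrev RelCohomology (n : ℤ) (Y : Set K.Cell) : Type (max u v w) :=
  K.relCocycles χ A n Y ⧸ (K.relCoboundaries χ A n Y).addSubgroupOf (K.relCocycles χ A n Y)

/-- Equivariant cocycles `Z^n_G(Y; A)` of a subcomplex `Y`. A cochain of `Y` is recorded by its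
extension by zero, and its coboundary has to vanish on the cells of `Y`. -/
def cocyclesOn (n : ℤ) (Y : Set K.Cell) : AddSubgroup (K.Total A) :=
  K.cochains χ A n Y ⊓
    (K.supported A fun _ σ => σ ∉ Y).comap (K.cochainD A n)

end groups

/-! ## Coboundaries square to zero -/

section lemmas

variable (A : Type w) [AddCommGroup A]

lemma groupD_groupD (β : K.Total A) : K.groupD A (K.groupD A β) = 0 := by
  funext p g σ
  match p with
  | 0 => rfl
  | 1 => simp [groupD]
  | p + 2 =>
    simp only [groupD, AddMonoidHom.coe_mk, ZeroHom.coe_mk, Pi.zero_apply, Finset.smul_sum]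
    rw [← Finset.sum_product']
    refine Finset.sum_involution
      (fun a _ => (a.1.succAbove a.2, a.2.predAbove a.1)) ?_ ?_ ?_ ?_
    · rintro ⟨i, j⟩ -
      have h : (g ∘ (i.succAbove j).succAbove) ∘ (j.predAbove i).succAbove
          = (g ∘ i.succAbove) ∘ j.succAbove := by
        funext k
        simp [Fin.succAbove_succAbove_succAbove_predAbove]
      simp only [h, smul_smul, ← add_smul, ← pow_add]
      rw [Fin.neg_one_pow_succAbove_add_predAbove]
      simp
    · rintro ⟨i, j⟩ - - h
      exact Fin.succAbove_ne i j (Prod.ext_iff.1 h).1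
    · simp
    · rintro ⟨i, j⟩ -
      simp [Fin.succAbove_succAbove_predAbove, Fin.predAbove_predAbove_succAbove]

lemma cobdry_apply (α : K.Total A) (p : ℕ) (g : Fin (p + 1) → G) (σ : K.Cell) :
    K.cobdry A α p g σ = ∑ τ ∈ (K.finite_faces σ).toFinset, K.inc σ τ • α p g τ := by
  refine finsum_eq_sum_of_support_subset _ fun τ h => ?_
  simp only [Finite.coe_toFinset, mem_ofPred_eq]
  exact fun h' => h (by simp [h'])

lemma groupD_cobdry (α : K.Total A) :
    K.groupD A (K.cobdry A α) = K.cobdry A (K.groupD A α) := by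
  funext p g σ
  rw [cobdry_apply]
  match p with
  | 0 => simp [groupD]
  | p + 1 =>
    simp only [groupD, AddMonoidHom.coe_mk, ZeroHom.coe_mk, cobdry_apply, Finset.smul_sum]
    rw [Finset.sum_comm]
    exact Finset.sum_congr rfl fun _ _ => Finset.sum_congr rfl fun _ _ => smul_comm _ _ _

lemma cobdry_cobdry (α : K.Total A) : K.cobdry A (K.cobdry A α) = 0 := by
  classical
  funext p g σ
  set F := (K.finite_faces σ).toFinset with hF
  set E := F.biUnion fun τ => (K.finite_faces τ).toFinset with hE
  have h1 : K.cobdry A (K.cobdry A α) p g σ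
      = ∑ τ ∈ F, ∑ ρ ∈ E, (K.inc σ τ * K.inc τ ρ) • α p g ρ := by
    rw [cobdry_apply]
    refine Finset.sum_congr rfl fun τ hτ => ?_
    rw [cobdry_apply, Finset.smul_sum]
    simp only [smul_smul]
    refine Finset.sum_subset (Finset.subset_biUnion_of_mem
      (fun τ => (K.finite_faces τ).toFinset) hτ) fun ρ _ hρ => ?_
    have : K.inc τ ρ = 0 := by simpa using hρ
    simp [this]
  rw [h1, Finset.sum_comm]
  refine Finset.sum_eq_zero fun ρ _ => ?_
  rw [← Finset.sum_smul]
  have h2 := K.inc_inc σ ρ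
  rw [finsum_eq_sum_of_support_subset (s := F)] at h2
  · simp [h2]
  · intro τ h
    simp only [hF, Finite.coe_toFinset, mem_ofPred_eq]
    exact fun h' => h (by simp [h'])

lemma cochainD_cochainD (n m : ℤ) (h : m = n + 1) (α : K.Total A) :
    K.cochainD A m (K.cochainD A n α) = 0 := by
  subst h
  simp only [cochainD, AddMonoidHom.add_apply, AddMonoidHom.smul_apply, map_add, map_zsmul,
    groupD_groupD, cobdry_cobdry, groupD_cobdry, Int.negOnePow_succ]
  simp

variable [MeasurableSpace G] [MeasurableSpace A] [MeasurableAdd₂ A] [MeasurableNeg A]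
variable (χ : G →* ℤˣ)

lemma measurable_zsmul' {B : Type*} [MeasurableSpace B] {f : B → A} (hf : Measurable f) (n : ℤ) :
    Measurable fun x => n • f x := by
  have hn : ∀ k : ℕ, Measurable fun x => k • f x := by
    intro k
    induction k with
    | zero => simp
    | succ k ih =>
      simp only [succ_nsmul]
      exact ih.add hf
  cases n with
  | ofNat k => simpa using hn k
  | negSucc k =>
    simp only [negSucc_zsmul]
    exact (hn (k + 1)).neg

variable {A χ}

lemma groupD_mem {β : K.Total A} (hβ : β ∈ K.equivariant χ A) :
    K.groupD A β ∈ K.equivariant χ A := by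
  refine ⟨fun p σ => ?_, fun p h g σ => ?_⟩
  · cases p with
    | zero => exact measurable_const
    | succ p =>
      change Measurable fun g => ∑ i : Fin (p + 2), (-1 : ℤ) ^ (i : ℕ) • β p (g ∘ i.succAbove) σ
      refine Finset.measurable_sum _ fun i _ => measurable_zsmul' A ?_ _
      have hm : Measurable fun g : Fin (p + 2) → G => g ∘ i.succAbove :=
        measurable_pi_lambda _ fun j => measurable_pi_apply _
      exact (hβ.1 p σ).comp hm
  · cases p with
    | zero => simp [groupD]
    | succ p =>
      simp only [groupD, AddMonoidHom.coe_mk, ZeroHom.coe_mk, Finset.smul_sum]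
      refine Finset.sum_congr rfl fun i _ => ?_
      rw [smul_comm, ← hβ.2 p h (g ∘ i.succAbove) σ]
      rfl

lemma cobdry_mem {β : K.Total A} (hβ : β ∈ K.equivariant χ A) :
    K.cobdry A β ∈ K.equivariant χ A := by
  refine ⟨fun p σ => ?_, fun p h g σ => ?_⟩
  · simp only [cobdry_apply]
    exact Finset.measurable_sum _ fun τ _ => measurable_zsmul' A (hβ.1 p τ) _
  · change ∑ᶠ τ, _ = _ • ∑ᶠ τ, _
    rw [smul_finsum' _ ((K.finite_faces σ).subset fun τ hτ h' => hτ (by simp [h'])),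
      ← finsum_comp_equiv (MulAction.toPerm h)]
    refine finsum_congr fun τ => ?_
    rw [MulAction.toPerm_apply, hβ.2, K.inc_smul]
    simp only [Units.smul_def, smul_smul]
    congr 1
    push_cast
    rcases Int.units_eq_one_or (K.sgn h τ) with h' | h' <;> simp [h'] <;> ring

lemma cochainD_mem {n m : ℤ} (h : m = n + 1) {β : K.Total A} {L : Set K.Cell}
    (hβ : β ∈ K.cochains χ A n L) :
    K.cochainD A n β ∈ K.cochains χ A m univ := by
  refine ⟨add_mem (K.groupD_mem hβ.1) (zsmul_mem (K.cobdry_mem hβ.1) _), ?_⟩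
  refine (K.supported A _).add_mem ?_ ((K.supported A _).zsmul_mem ?_ _)
  · intro p g σ hne
    cases p with
    | zero => exact absurd rfl hne
    | succ p =>
      change ∑ i : Fin (p + 2), (-1 : ℤ) ^ (i : ℕ) • β p (g ∘ i.succAbove) σ ≠ 0 at hne
      obtain ⟨i, -, hi⟩ := Finset.exists_ne_zero_of_sum_ne_zero hne
      have := (hβ.2 p (g ∘ i.succAbove) σ fun h' => hi (by simp [h'])).1
      refine ⟨?_, mem_univ _⟩
      push_cast
      omega
  · intro p g σ hne
    rw [cobdry_apply] at hne
    obtain ⟨τ, -, hτ⟩ := Finset.exists_ne_zero_of_sum_ne_zero hne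
    have h1 := (hβ.2 p g τ fun h' => hτ (by simp [h'])).1
    have h2 := K.dim_of_inc σ τ fun h' => hτ (by simp [h'])
    refine ⟨?_, mem_univ _⟩
    omega

end lemmas

/-! ## The connecting homomorphism of a pair -/

section connecting

variable [MeasurableSpace G]
variable (χ : G →* ℤˣ) (A : Type w) [AddCommGroup A] [MeasurableSpace A]
variable [MeasurableAdd₂ A] [MeasurableNeg A]

/-- The connecting map `Z^n_G(Y; A) → H^{n+1}_G(K, Y; A)`: extend a cocycle of `Y` by zero to a
cochain of `K` and take its coboundary. -/
def connecting (n m : ℤ) (h : m = n + 1) (Y : Set K.Cell) :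
    K.cocyclesOn χ A n Y →+ K.RelCohomology χ A m Y :=
  (QuotientAddGroup.mk' _).comp
    (((K.cochainD A n).comp (K.cocyclesOn χ A n Y).subtype).codRestrict (K.relCocycles χ A m Y)
      fun ν => by
        have h1 := K.cochainD_mem h ν.2.1
        refine ⟨⟨h1.1, fun p g σ hne => ⟨(h1.2 p g σ hne).1, ν.2.2 p g σ hne⟩⟩, ?_⟩
        exact K.cochainD_cochainD A n m h _)

end connecting

/-! ## Coefficients and the Bockstein -/

/-- Change of coefficients. -/
def mapCoeff {A B : Type*} [AddCommGroup A] [AddCommGroup B] (φ : A →+ B) :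
    K.Total A →+ K.Total B where
  toFun β := fun p g σ => φ (β p g σ)
  map_zero' := by
    funext p g σ
    simp
  map_add' a b := by
    funext p g σ
    simp

/-- `b ∈ H_{r'}^G(L, ℤ)`, `r' = r - 1`, is the Bockstein of `a ∈ H_r^G(L, U(1))`: lift a cycle
representing `a` to a real chain, and take its total boundary, which is an integral cycle. -/
def IsBockstein [MeasurableSpace G] (χ : G →* ℤˣ) {r r' : ℤ} {L : Set K.Cell}
    (a : K.Homology χ UnitAddCircle r L) (b : K.Homology χ ℤ r' L) : Prop :=
  ∃ x ∈ K.chains χ ℝ r L, ∃ ω : K.cycles χ UnitAddCircle r L, ∃ z : K.cycles χ ℤ r' L,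
    K.mapCoeff (QuotientAddGroup.mk' (AddSubgroup.zmultiples (1 : ℝ))) x = ω ∧
    K.chainD ℝ r x = K.mapCoeff (Int.castAddHom ℝ) z ∧
    a = QuotientAddGroup.mk ω ∧ b = QuotientAddGroup.mk z

/-! ## The dual cell complex and duality -/

/-- The vertices, i.e. the `0`-skeleton. -/
def vertices : Set K.Cell := {σ | K.dim σ = 0}

/-- The `(n - 1)`-skeleton. -/
def skeletonLT (n : ℕ) : Set K.Cell := {σ | K.dim σ < n}

/-- The dual cell complex of a cellulated oriented `d`-manifold. The dual cell `σ^∨` of a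
`k`-cell `σ` has dimension `d - k`; it is oriented by the orientations of `σ` and of the manifold,
so that `[τ^∨ : σ^∨] = [σ : τ]`, and `g` carries the oriented cell `σ^∨` to `(gσ)^∨` up to the
sign `or g` with which `g` acts on the orientation of the manifold. -/
def dual (d : ℕ) (hd : ∀ σ, K.dim σ ≤ d) (or : G →* ℤˣ) : GCellComplex.{u, v} G where
  Cell := K.Cell
  action := K.action
  dim σ := d - K.dim σ
  inc σ τ := K.inc τ σ
  sgn g σ := or g * K.sgn g σ
  dim_smul g σ := by rw [K.dim_smul]
  dim_of_inc σ τ h := by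
    have h1 := K.dim_of_inc τ σ h
    have h2 := hd τ
    omega
  finite_faces := K.finite_cofaces
  finite_cofaces := K.finite_faces
  inc_inc σ ρ := by
    simpa only [mul_comm] using K.inc_inc ρ σ
  sgn_mul g h σ := by
    rw [map_mul, K.sgn_mul]
    exact mul_mul_mul_comm _ _ _ _
  inc_smul g σ τ := by
    rw [K.inc_smul]
    rcases Int.units_eq_one_or (or g) with h' | h' <;> simp [h', mul_comm]

section duality

variable [MeasurableSpace G]
variable (χ : G →* ℤˣ) (A : Type w) [AddCommGroup A] [MeasurableSpace A]
variable [MeasurableAdd₂ A] [MeasurableNeg A]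
variable (d : ℕ) (hd : ∀ σ, K.dim σ ≤ d) (or : G →* ℤˣ)

lemma dual_equivariant :
    K.equivariant χ A ≤ (K.dual d hd or).equivariant (χ * or) A := by
  rintro β ⟨h1, h2⟩
  refine ⟨h1, fun p h g σ => (h2 p h g σ).trans ?_⟩
  change _ = (χ h * or h * (or h * K.sgn h σ)) • β p g σ
  congr 1
  rcases Int.units_eq_one_or (or h) with h' | h' <;> simp [h']

lemma dual_chains {r n : ℤ} (h : n = d - r) {β : K.Total A}
    (hβ : β ∈ K.chains χ A r K.vertices) :
    β ∈ (K.dual d hd or).cochains (χ * or) A n ((K.dual d hd or).skeletonLT d)ᶜ := by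
  refine ⟨K.dual_equivariant χ A d hd or hβ.1, fun p g σ hne => ?_⟩
  obtain ⟨h1, h2⟩ := hβ.2 p g σ hne
  have h3 : K.dim σ = 0 := h2
  refine ⟨?_, ?_⟩
  · change ((d - K.dim σ : ℕ) : ℤ) + p = n
    rw [h3] at h1 ⊢
    simp only [Nat.sub_zero]
    omega
  · change ¬ (d - K.dim σ < d)
    omega

lemma bdry_of_vertices {r : ℤ} {β : K.Total A} (hβ : β ∈ K.chains χ A r K.vertices) :
    K.bdry A β = 0 := by
  funext p g τ
  refine finsum_eq_zero_of_forall_eq_zero fun σ => ?_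
  by_contra hne
  have h1 := K.dim_of_inc σ τ fun h' => hne (by simp [h'])
  have h2 : K.dim σ = 0 := (hβ.2 p g σ fun h' => hne (by simp [h'])).2
  omega

lemma chainD_of_vertices {r : ℤ} {β : K.Total A} (hβ : β ∈ K.chains χ A r K.vertices) :
    K.chainD A r β = (r.negOnePow : ℤ) • K.groupD A β := by
  simp [chainD, K.bdry_of_vertices χ A hβ]

lemma dual_cochainD_of_vertices {r : ℤ} (n : ℤ) {β : K.Total A}
    (hβ : β ∈ K.chains χ A r K.vertices) :
    (K.dual d hd or).cochainD A n β = K.groupD A β := by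
  change K.groupD A β + (n.negOnePow : ℤ) • K.bdry A β = _
  simp [K.bdry_of_vertices χ A hβ]

/-- Poincaré–Lefschetz duality `H_r^G(X_0, A) → H^{d-r}_G(X^∨, X^∨_{d-1}; A^or)` for the
`0`-skeleton, induced by `σ ↦ σ^∨`. -/
def poincareLefschetz (r n : ℤ) (h : n = d - r) :
    K.Homology χ A r K.vertices →+
      (K.dual d hd or).RelCohomology (χ * or) A n ((K.dual d hd or).skeletonLT d) :=
  QuotientAddGroup.map _ _
    ((AddMonoidHom.codRestrict (K.cycles χ A r K.vertices).subtype
      ((K.dual d hd or).relCocycles (χ * or) A n ((K.dual d hd or).skeletonLT d))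
      fun c => by
        refine ⟨K.dual_chains χ A d hd or h c.2.1, ?_⟩
        have h1 := (K.chainD_of_vertices χ A c.2.1).symm.trans c.2.2
        refine (K.dual_cochainD_of_vertices χ A d hd or n c.2.1).trans ?_
        rcases Int.units_eq_one_or r.negOnePow with h' | h' <;> simp [h'] at h1 <;> exact h1))
    (by
      rintro ⟨c, hc⟩ ⟨m, hm, hmc⟩
      refine ⟨((r + 1).negOnePow : ℤ) • m,
        zsmul_mem (K.dual_chains χ A d hd or (by omega) hm) _, ?_⟩
      have h1 := K.chainD_of_vertices χ A hm
      refine (map_zsmul ((K.dual d hd or).cochainD A (n - 1)) _ m).trans ?_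
      refine Eq.trans ?_ (h1.symm.trans hmc)
      exact congrArg (((r + 1).negOnePow : ℤ) • ·)
        (K.dual_cochainD_of_vertices χ A d hd or (n - 1) hm))

end duality

/-! ## Sites -/

/-- A `G`-set, as a cell complex that has only `0`-cells. -/
abbrev points (G : Type v) [Group G] (Λ : Type w) [MulAction G Λ] : GCellComplex.{w, v} G where
  Cell := Λ
  dim _ := 0
  inc _ _ := 0
  sgn _ _ := 1
  dim_smul _ _ := rfl
  dim_of_inc _ _ h := absurd rfl h
  finite_faces _ := by simp
  finite_cofaces _ := by simp
  inc_inc _ _ := by simp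
  sgn_mul _ _ _ := by simp
  inc_smul _ _ _ := by simp

/-- An equivariant, finite-to-one map from a `G`-set to the vertices of a cell complex. -/
structure VertexMap (Λ : Type w) [MulAction G Λ] where
  toFun : Λ → K.Cell
  map_smul : ∀ (g : G) s, toFun (g • s) = g • toFun s
  dim_eq : ∀ s, K.dim (toFun s) = 0
  sgn_eq : ∀ g s, K.sgn g (toFun s) = 1
  finite_fiber : ∀ σ, {s | toFun s = σ}.Finite

namespace VertexMap

variable {K} {Λ : Type w} [MulAction G Λ] (f : K.VertexMap Λ)

/-- Pushforward of chains, `(f_* β)(σ) = ∑_{s, f(s) = σ} β(s)`. -/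
def pushTotal (A : Type*) [AddCommGroup A] : (points G Λ).Total A →+ K.Total A where
  toFun β := fun p g σ => ∑ s ∈ (f.finite_fiber σ).toFinset, β p g s
  map_zero' := by
    funext p g σ
    exact Finset.sum_const_zero
  map_add' a b := by
    funext p g σ
    exact Finset.sum_add_distrib

lemma groupD_push (A : Type*) [AddCommGroup A] (β : (points G Λ).Total A) :
    K.groupD A (f.pushTotal A β) = f.pushTotal A ((points G Λ).groupD A β) := by
  funext p g σ
  cases p with
  | zero => exact Finset.sum_const_zero.symm
  | succ p =>
    simp only [groupD, pushTotal, AddMonoidHom.coe_mk, ZeroHom.coe_mk, Finset.smul_sum]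
    exact Finset.sum_comm

variable [MeasurableSpace G] (χ : G →* ℤˣ) (A : Type*) [AddCommGroup A] [MeasurableSpace A]
variable [MeasurableAdd₂ A] [MeasurableNeg A]

lemma push_mem {r : ℤ} {β : (points G Λ).Total A} (hβ : β ∈ (points G Λ).chains χ A r univ) :
    f.pushTotal A β ∈ K.chains χ A r K.vertices := by
  refine ⟨⟨fun p σ => ?_, fun p h g σ => ?_⟩, fun p g σ hne => ?_⟩
  · exact Finset.measurable_sum _ fun s _ => hβ.1.1 p s
  · change ∑ s ∈ (f.finite_fiber (h • σ)).toFinset, β p (fun i => h * g i) s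
      = (χ h * K.sgn h σ) • ∑ s ∈ (f.finite_fiber σ).toFinset, β p g s
    rw [Finset.smul_sum]
    symm
    refine Finset.sum_bij (fun (s : Λ) _ => h • s) ?_ ?_ ?_ ?_
    · intro s hs
      have hs : f.toFun s = σ := by simpa using hs
      simp [f.map_smul, hs]
    · intro s _ t _ hst
      exact MulAction.injective h hst
    · intro t ht
      have ht : f.toFun t = h • σ := by simpa using ht
      exact ⟨h⁻¹ • t, by simp [f.map_smul, ht], by simp⟩
    · intro s hs
      have hs : f.toFun s = σ := by simpa using hs
      subst hs
      rw [f.sgn_eq]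
      exact (hβ.1.2 p h g s).symm
  · obtain ⟨s, hs, hs'⟩ := Finset.exists_ne_zero_of_sum_ne_zero hne
    have hs : f.toFun s = σ := by simpa using hs
    subst hs
    have h1 : ((0 : ℕ) : ℤ) - p = r := (hβ.2 p g s hs').1
    refine ⟨?_, f.dim_eq s⟩
    rw [f.dim_eq]
    exact h1

lemma chainD_push {r : ℤ} {β : (points G Λ).Total A}
    (hβ : β ∈ (points G Λ).chains χ A r univ) :
    K.chainD A r (f.pushTotal A β) = f.pushTotal A ((points G Λ).chainD A r β) := by
  rw [K.chainD_of_vertices χ A (f.push_mem χ A hβ), f.groupD_push,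
    (points G Λ).chainD_of_vertices χ A (r := r) ⟨hβ.1, fun p g s h => ⟨(hβ.2 p g s h).1, rfl⟩⟩,
    map_zsmul]

lemma chains_mono {r : ℤ} {L L' : Set K.Cell} (h : L ⊆ L') :
    K.chains χ A r L ≤ K.chains χ A r L' :=
  fun _ hβ => ⟨hβ.1, fun p g σ hne => ⟨(hβ.2 p g σ hne).1, h (hβ.2 p g σ hne).2⟩⟩

/-- The map `f_* : H_r^G(Λ, A) → H_r^G(L, A)` induced by `f`, for a subcomplex `L` containing the
vertices. -/
def push (r : ℤ) (L : Set K.Cell) (hL : K.vertices ⊆ L) :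
    (points G Λ).Homology χ A r univ →+ K.Homology χ A r L :=
  QuotientAddGroup.map _ _
    (AddMonoidHom.codRestrict
      ((f.pushTotal A).comp ((points G Λ).cycles χ A r univ).subtype) (K.cycles χ A r L)
      fun c => by
        refine ⟨chains_mono χ A hL (f.push_mem χ A c.2.1), ?_⟩
        have h1 : (points G Λ).chainD A r c = 0 := c.2.2
        refine (f.chainD_push χ A c.2.1).trans ?_
        rw [h1, map_zero])
    (by
      rintro ⟨c, hc⟩ ⟨m, hm, hmc⟩
      refine ⟨f.pushTotal A m, chains_mono χ A hL (f.push_mem χ A hm), ?_⟩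
      rw [f.chainD_push χ A hm, hmc]
      rfl)

end VertexMap

end GCellComplex

/-! ## Cellulated manifolds with a group action -/

section topology

/-- The cells, of all dimensions, of a CW decomposition of the space `X`. -/
abbrev Cells (X : Type u) [TopologicalSpace X] [CWComplex (univ : Set X)] : Type u :=
  Σ n, RelCWComplex.cell (univ : Set X) n

variable {X : Type u} [TopologicalSpace X] [CWComplex (univ : Set X)]

/-- The open cell, as a subset of the space. -/
def Cells.opn (σ : Cells X) : Set X := RelCWComplex.openCell σ.1 σ.2

/-- The closed cell, as a subset of the space. -/
def Cells.closed (σ : Cells X) : Set X := RelCWComplex.closedCell σ.1 σ.2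

/-- A cell decomposition of the oriented `d`-manifold `X`, on which the group `G` acts: the given
CW structure is regular and locally finite, `G` maps `k`-cells to `k`-cells, and a group element
that preserves a cell fixes it pointwise. The cells and the manifold are oriented.

The orientations of the cells are recorded by the incidence numbers `inc σ τ = [σ : τ]`, which for
a regular CW complex are characterized by `inc_eq_zero`, `inc_unit`, `inc_edge` and `inc_inc`, and by
the signs `sgn g σ` with which `g` carries the oriented cell `σ` to the oriented cell `g • σ`.
The orientation of `X` is recorded by the sign `orient σ` that compares it with the orientation of
the `d`-cell `σ`, so that the sum of all the `d`-cells, with these signs, is a cycle; and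
`or g` is the sign with which `g` acts on the orientation of `X`. -/
structure OrientedGCellulation (G : Type v) [Group G] (X : Type u) [TopologicalSpace X]
    [CWComplex (univ : Set X)] [MulAction G X] (d : ℕ) where
  regular : ∀ σ : Cells X,
    InjOn (RelCWComplex.map (C := (univ : Set X)) σ.1 σ.2) (Metric.closedBall 0 1)
  locallyFinite : LocallyFinite (Cells.closed : Cells X → Set X)
  dim_le : ∀ σ : Cells X, σ.1 ≤ d
  [action : MulAction G (Cells X)]
  smul_opn : ∀ (g : G) (σ : Cells X), (g • σ).opn = (fun x => g • x) '' σ.opn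
  smul_dim : ∀ (g : G) (σ : Cells X), (g • σ).1 = σ.1
  smul_eq_self : ∀ (g : G) (σ : Cells X), g • σ = σ → ∀ x ∈ σ.opn, g • x = x
  inc : Cells X → Cells X → ℤ
  inc_eq_zero : ∀ σ τ, ¬ (σ.1 = τ.1 + 1 ∧ τ.opn ⊆ σ.closed) → inc σ τ = 0
  inc_unit : ∀ σ τ, σ.1 = τ.1 + 1 → τ.opn ⊆ σ.closed → inc σ τ = 1 ∨ inc σ τ = -1
  inc_edge : ∀ σ, σ.1 = 1 → ∑ᶠ τ, inc σ τ = 0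
  inc_inc : ∀ σ ρ, ∑ᶠ τ, inc σ τ * inc τ ρ = 0
  sgn : G → Cells X → ℤˣ
  sgn_vertex : ∀ g σ, σ.1 = 0 → sgn g σ = 1
  sgn_stabilizer : ∀ (g : G) σ, g • σ = σ → sgn g σ = 1
  sgn_mul : ∀ (g h : G) σ, sgn (g * h) σ = sgn g (h • σ) * sgn h σ
  inc_smul : ∀ (g : G) σ τ, inc (g • σ) (g • τ) = ((sgn g σ * sgn g τ : ℤˣ) : ℤ) * inc σ τ
  orient : Cells X → ℤˣ
  orient_cycle : ∀ τ, τ.1 + 1 = d → ∑ᶠ σ, (orient σ : ℤ) * inc σ τ = 0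
  or : G →* ℤˣ
  orient_smul : ∀ (g : G) σ, σ.1 = d → orient (g • σ) = or g * sgn g σ * orient σ

/-- A lattice of sites: a `G`-set `Λ` with an equivariant finite-to-one map to `X`, such that all
sites lie on vertices of the cell decomposition; for example an invariant set of vertices. -/
structure Sites (G : Type v) [Group G] (Λ : Type w) [MulAction G Λ] (X : Type u)
    [TopologicalSpace X] [CWComplex (univ : Set X)] [MulAction G X] where
  toFun : Λ → X
  map_smul : ∀ (g : G) s, toFun (g • s) = g • toFun s
  finite_fiber : ∀ x, {s | toFun s = x}.Finite
  mem_vertex : ∀ s, ∃ σ : Cells X, σ.1 = 0 ∧ toFun s ∈ σ.opn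

namespace OrientedGCellulation

variable {G : Type v} [Group G] [MulAction G X] {d : ℕ} (C : OrientedGCellulation G X d)

lemma finite_nonempty_inter (C : OrientedGCellulation G X d) (σ : Cells X) :
    {τ : Cells X | (τ.closed ∩ σ.closed).Nonempty}.Finite :=
  C.locallyFinite.finite_nonempty_inter_compact RelCWComplex.isCompact_closedCell

lemma face_of_inc {σ τ : Cells X} (h : C.inc σ τ ≠ 0) : σ.1 = τ.1 + 1 ∧ τ.opn ⊆ σ.closed := by
  by_contra h'
  exact h (C.inc_eq_zero σ τ h')

lemma nonempty_of_inc {σ τ : Cells X} (h : C.inc σ τ ≠ 0) : (σ.closed ∩ τ.closed).Nonempty := by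
  obtain ⟨x, hx⟩ := RelCWComplex.openCell_nonempty (C := (univ : Set X)) τ.1 τ.2
  exact ⟨x, (C.face_of_inc h).2 hx, RelCWComplex.openCell_subset_closedCell _ _ hx⟩

/-- The cellular data of the decomposition. -/
def toGCellComplex : GCellComplex.{u, v} G where
  Cell := Cells X
  action := C.action
  dim σ := σ.1
  inc := C.inc
  sgn := C.sgn
  dim_smul := C.smul_dim
  dim_of_inc _ _ h := (C.face_of_inc h).1
  finite_faces σ := (C.finite_nonempty_inter σ).subset fun τ h => by
    simpa only [mem_ofPred_eq, inter_comm] using C.nonempty_of_inc h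
  finite_cofaces τ := (C.finite_nonempty_inter τ).subset fun σ h => C.nonempty_of_inc h
  inc_inc := C.inc_inc
  sgn_mul := C.sgn_mul
  inc_smul := C.inc_smul

/-- The dual cell complex `X^∨`. -/
abbrev dualComplex : GCellComplex.{u, v} G := C.toGCellComplex.dual d C.dim_le C.or

lemma eq_of_mem_opn {σ τ : Cells X} {x : X} (h : x ∈ σ.opn) (h' : x ∈ τ.opn) : σ = τ :=
  RelCWComplex.eq_of_not_disjoint_openCell (C := (univ : Set X))
    (not_disjoint_iff.2 ⟨x, h, h'⟩)

lemma eq_of_mem_vertex {σ : Cells X} (hσ : σ.1 = 0) {x y : X} (hx : x ∈ σ.opn)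
    (hy : y ∈ σ.opn) : x = y := by
  obtain ⟨n, e⟩ := σ
  obtain rfl : n = 0 := hσ
  simp only [Cells.opn, RelCWComplex.openCell_zero_eq_singleton, mem_singleton_iff] at hx hy
  rw [hx, hy]

/-- The vertices of the cell decomposition at which the sites lie. -/
def vertexMap {Λ : Type w} [MulAction G Λ] (f : Sites G Λ X) : C.toGCellComplex.VertexMap Λ where
  toFun s := (f.mem_vertex s).choose
  map_smul g s := by
    refine eq_of_mem_opn (f.mem_vertex (g • s)).choose_spec.2 ?_
    rw [f.map_smul]
    refine (C.smul_opn g (f.mem_vertex s).choose).symm.subset ?_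
    exact mem_image_of_mem _ (f.mem_vertex s).choose_spec.2
  dim_eq s := (f.mem_vertex s).choose_spec.1
  sgn_eq g s := C.sgn_vertex g _ (f.mem_vertex s).choose_spec.1
  finite_fiber σ := by
    by_cases h : ∃ s, (f.mem_vertex s).choose = σ
    · obtain ⟨s, rfl⟩ := h
      refine (f.finite_fiber (f.toFun s)).subset fun t ht => ?_
      have h1 := (f.mem_vertex t).choose_spec.2
      have ht : (f.mem_vertex t).choose = (f.mem_vertex s).choose := ht
      rw [ht] at h1
      exact eq_of_mem_vertex (f.mem_vertex s).choose_spec.1 h1 (f.mem_vertex s).choose_spec.2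
    · refine finite_empty.subset fun t ht => h ⟨t, ht⟩

end OrientedGCellulation

end topology

/-! ## Anomalous textures and defect networks

The homomorphism `μ : G → {±1}` tells the unitary from the anti-unitary elements of `G`: the group
acts through this sign on the coefficients `U(1) = ℝ/ℤ`, and on `ℝ` and `ℤ`. -/

section anomalies

open GCellComplex

variable {G : Type v} [Group G] [MeasurableSpace G] (μ : G →* ℤˣ)

/-- The group `H_{-2}^G(Λ, U(1))` of anomalous textures on a lattice of sites. -/
abbrev AnomalousTexture (Λ : Type w) [MulAction G Λ] : Type (max v w) :=
  (points G Λ).Homology μ UnitAddCircle (-2) univ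

variable {X : Type u} [TopologicalSpace X] [CWComplex (univ : Set X)] [MulAction G X] {d : ℕ}
variable (C : OrientedGCellulation G X d)

/-- The `(d - 1)`-skeleton of the dual cell complex. -/
abbrev dualSkeleton : Set C.dualComplex.Cell := C.dualComplex.skeletonLT d

/-- The invertible-substrate in-cohomology defect networks on `X` that are specified on all the
cells of positive dimension, and may be anomalous at the vertices: degree `d + 2` equivariant
cocycles on the `(d - 1)`-skeleton of the dual cell complex, with coefficients in `ℤ`, twisted by
`μ` and by the orientation character. -/
abbrev DefectNetwork : Type (max u v) :=
  C.dualComplex.cocyclesOn (μ * C.or) ℤ (d + 2) (dualSkeleton C)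

/-- The anomaly of a defect network, in `H^{d+3}_G(X, X^∨_{d-1}; ℤ^or)`. -/
def DefectNetwork.anomaly {μ : G →* ℤˣ} {C : OrientedGCellulation G X d}
    (ν : DefectNetwork μ C) :
    C.dualComplex.RelCohomology (μ * C.or) ℤ (d + 3) (dualSkeleton C) :=
  C.dualComplex.connecting (μ * C.or) ℤ (d + 2) (d + 3) (by ring) (dualSkeleton C) ν

variable {Λ : Type w} [MulAction G Λ] (f : Sites G Λ X)

/-- The anomaly of the network cancels the anomalous texture: the class in
`H^{d+3}_G(X, X^∨_{d-1}; ℤ^or)` that corresponds to the texture under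
`H_{-2}^G(Λ, U(1)) → H_{-2}^G(X_0, U(1)) → H_{-3}^G(X_0, ℤ) ≅ H^{d+3}_G(X, X^∨_{d-1}; ℤ^or)`
(inclusion, Bockstein, duality) and the anomaly of the network add up to zero. -/
def DefectNetwork.Cancels {μ : G →* ℤˣ} {C : OrientedGCellulation G X d}
    (ν : DefectNetwork μ C) (a : AnomalousTexture μ Λ) : Prop :=
  ∃ b : C.toGCellComplex.Homology μ ℤ (-3) C.toGCellComplex.vertices,
    C.toGCellComplex.IsBockstein μ
      ((C.vertexMap f).push μ UnitAddCircle (-2) C.toGCellComplex.vertices subset_rfl a) b ∧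
    ν.anomaly + C.toGCellComplex.poincareLefschetz μ ℤ d C.dim_le C.or (-3) (d + 3) (by ring) b
      = 0

/-- The map `H_{-2}^G(Λ, U(1)) → H_{-2}^G(X, U(1))` induced by `Λ → X`. -/
def textureClass : AnomalousTexture μ Λ →+
    C.toGCellComplex.Homology μ UnitAddCircle (-2) univ :=
  (C.vertexMap f).push μ UnitAddCircle (-2) univ (subset_univ _)

end anomalies

end CrystalAnomaly

end

/-!
A cochain that realizes the cancellation, minus the network extended by zero, is an integral chain
of `X` whose boundary is the Bockstein of the texture; the signs of the dual complex differ from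
those of `X` only by the factor `(-1)^{dk}` on `k`-cells (`exists_connecting_add_eq_zero_iff`). So a
texture can be cancelled if and only if the Bockstein of its class in `H_{-2}^G(X_0, U(1))` vanishes
in `H_{-3}^G(X, ℤ)`. By the coefficient sequence `ℤ → ℝ → U(1)` this holds if the class vanishes in
`H_{-2}^G(X, U(1))`, for which `ℝ/ℤ`-valued equivariant chains have to be lifted to real ones
(`exists_real_lift`). The converse needs `H_{-2}^G(X, ℝ) = 0`, which is where compactness of the
isotropy groups enters (`exists_chainD_eq`): filtering by the dimension of the cells and choosing a
cell in each orbit, one is left with the measurable cohomology in positive degrees, with real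
coefficients, of the isotropy group `H` of a cell, which is compact, and open by local finiteness.

That this cohomology vanishes (`exists_cob_eq`) is not a matter of averaging, since a measurable
cocycle `β` need not be integrable. It is first replaced by a bounded cocycle in its class. Assign
to each simplex `(g₀, …, g_k)` an additional vertex, its apex, measurably and `H`-equivariantly.
Replacing each simplex by the cone, with vertex the apex, over the subdivided boundary is a
subdivision that is chain homotopic to the identity (`sub_subdiv`). The simplices of the subdivision
have as vertices the apices of the faces in a flag. If `N` is large, then the tuples with `|β| ≤ N`
are so abundant that the apices can be chosen, by induction on the dimension, such that `|β| ≤ N` on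
all the simplices of all the subdivisions: the apex of a simplex has to avoid a set of measure at
most `1/2` that is determined by the apices of its proper faces (`exists_apex`). That the apex can
be chosen measurably is a selection theorem for sets whose sections have large measure
(`exists_measurable_selection`). The subdivided cocycle is then bounded, and can be averaged.
-/
namespace CrystalAnomaly

open MeasureTheory Topology
open scoped ENNReal

/-! ### Measurable selection from sections of large measure -/

section selection

variable {Y : Type*} [MeasurableSpace Y]

/-- `E ⊆ Y × ℝ` can be approximated from inside, uniformly in `y`, by measurable sets all of whose
sections are closed. -/
def ClosedApprox (m : Measure ℝ) (E : Set (Y × ℝ)) : Prop :=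
  ∀ ε : ℝ≥0∞, ε ≠ 0 → ∃ F ⊆ E, MeasurableSet F ∧ (∀ y, IsClosed (Prod.mk y ⁻¹' F)) ∧
    ∀ y, m (Prod.mk y ⁻¹' (E \ F)) ≤ ε

variable {m : Measure ℝ}

lemma ClosedApprox.iInter {E : ℕ → Set (Y × ℝ)} (h : ∀ n, ClosedApprox m (E n)) :
    ClosedApprox m (⋂ n, E n) := by
  intro ε hε
  obtain ⟨δ, hδ, hsum⟩ := ENNReal.exists_pos_sum_of_countable' hε ℕ
  choose F hFE hFm hFc hF using fun n => h n (δ n) (hδ n).ne'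
  refine ⟨⋂ n, F n, Set.iInter_mono hFE, MeasurableSet.iInter hFm, fun y => ?_, fun y => ?_⟩
  · rw [Set.preimage_iInter]
    exact isClosed_iInter fun n => hFc n y
  · calc m (Prod.mk y ⁻¹' ((⋂ n, E n) \ ⋂ n, F n))
        ≤ m (⋃ n, Prod.mk y ⁻¹' (E n \ F n)) := by
          refine measure_mono fun z hz => ?_
          obtain ⟨h1, h2⟩ := hz
          simp only [Set.mem_iInter, not_forall] at h1 h2
          obtain ⟨n, hn⟩ := h2
          exact Set.mem_iUnion.2 ⟨n, h1 n, hn⟩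
      _ ≤ ∑' n, m (Prod.mk y ⁻¹' (E n \ F n)) := measure_iUnion_le _
      _ ≤ ∑' n, δ n := ENNReal.tsum_le_tsum fun n => hF n y
      _ ≤ ε := hsum.le

lemma ClosedApprox.iUnion [IsFiniteMeasure m] {E : ℕ → Set (Y × ℝ)}
    (hE : ∀ n, MeasurableSet (E n)) (h : ∀ n, ClosedApprox m (E n)) :
    ClosedApprox m (⋃ n, E n) := by
  classical
  intro ε hε
  obtain ⟨δ, hδ, hsum⟩ := ENNReal.exists_pos_sum_of_countable' (ENNReal.half_pos hε).ne' ℕ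
  choose F hFE hFm hFc hF using fun n => h n (δ n) (hδ n).ne'
  -- finitely many of the sets exhaust the section at `y` up to `ε / 2`; how many depends on `y`
  set R : ℕ → Set (Y × ℝ) := fun N => (⋃ n, E n) \ ⋃ n ∈ Finset.range N, E n with hR
  have hRm : ∀ N, MeasurableSet (R N) := fun N =>
    (MeasurableSet.iUnion hE).diff (Finset.measurableSet_biUnion _ fun n _ => hE n)
  have hanti : Antitone R := fun N M hNM => Set.sdiff_subset_sdiff_right <|
    Set.biUnion_subset_biUnion_left fun n hn => Finset.range_subset_range.2 hNM hn
  have hex : ∀ y, ∃ N, m (Prod.mk y ⁻¹' R N) < ε / 2 := by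
    intro y
    have h1 := tendsto_measure_iInter_atTop (μ := m) (s := fun N => Prod.mk y ⁻¹' R N)
      (fun N => (measurable_prodMk_left (hRm N)).nullMeasurableSet)
      (fun N M hNM => Set.preimage_mono (hanti hNM)) ⟨0, measure_ne_top _ _⟩
    have h2 : ⋂ N, Prod.mk y ⁻¹' R N = ∅ := by
      refine Set.eq_empty_of_forall_notMem fun z hz => ?_
      simp only [Set.mem_iInter] at hz
      obtain ⟨n, hn⟩ := Set.mem_iUnion.1 (hz 0).1
      exact (hz (n + 1)).2 (Set.mem_biUnion (Finset.coe_range _ ▸ Nat.lt_succ_self n) hn)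
    rw [h2, measure_empty] at h1
    exact ((tendsto_order.1 h1).2 _ (ENNReal.half_pos hε)).exists
  have hmeas : ∀ N, MeasurableSet {y | m (Prod.mk y ⁻¹' R N) < ε / 2} := fun N =>
    measurableSet_lt (measurable_measure_prodMk_left (hRm N)) measurable_const
  have hfind : Measurable fun y => Nat.find (hex y) := measurable_find hex hmeas
  refine ⟨⋃ n, ((fun y => Nat.find (hex y)) ⁻¹' Set.Ioi n) ×ˢ Set.univ ∩ F n, ?_, ?_, ?_, ?_⟩
  · exact Set.iUnion_mono fun n => Set.inter_subset_right.trans (hFE n)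
  · exact MeasurableSet.iUnion fun n =>
      ((hfind measurableSet_Ioi).prod MeasurableSet.univ).inter (hFm n)
  · intro y
    have : Prod.mk y ⁻¹' (⋃ n, ((fun y => Nat.find (hex y)) ⁻¹' Set.Ioi n) ×ˢ Set.univ ∩ F n)
        = ⋃ n ∈ Finset.range (Nat.find (hex y)), Prod.mk y ⁻¹' F n := by
      ext z
      simp
    rw [this]
    exact isClosed_biUnion_finset fun n _ => hFc n y
  · intro y
    calc _
        ≤ m (Prod.mk y ⁻¹' R (Nat.find (hex y)) ∪ ⋃ n, Prod.mk y ⁻¹' (E n \ F n)) := by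
          refine measure_mono fun z hz => ?_
          obtain ⟨h1, h2⟩ := hz
          by_cases hz' : (y, z) ∈ R (Nat.find (hex y))
          · exact Or.inl hz'
          · right
            have h3 : (y, z) ∈ ⋃ n ∈ Finset.range (Nat.find (hex y)), E n := by
              by_contra h4
              exact hz' ⟨h1, h4⟩
            simp only [Set.mem_iUnion, Finset.mem_range] at h3
            obtain ⟨n, hn, hn'⟩ := h3
            refine Set.mem_iUnion.2 ⟨n, hn', fun hF' => h2 ?_⟩
            exact Set.mem_iUnion.2 ⟨n, ⟨hn, trivial⟩, hF'⟩
      _ ≤ m (Prod.mk y ⁻¹' R (Nat.find (hex y))) + m (⋃ n, Prod.mk y ⁻¹' (E n \ F n)) :=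
          measure_union_le _ _
      _ ≤ ε / 2 + ∑' n, δ n := by
          gcongr
          · exact (Nat.find_spec (hex y)).le
          · exact (measure_iUnion_le _).trans (ENNReal.tsum_le_tsum fun n => hF n y)
      _ ≤ ε / 2 + ε / 2 := by gcongr
      _ = ε := ENNReal.add_halves ε

lemma closedApprox_rectangle [IsFiniteMeasure m] {A : Set Y} {B : Set ℝ} (hA : MeasurableSet A)
    (hB : MeasurableSet B) : ClosedApprox m (A ×ˢ B) ∧ ClosedApprox m (A ×ˢ B)ᶜ := by
  classical
  constructor
  · intro ε hε
    obtain ⟨K, hKB, hK, hK'⟩ := hB.exists_isClosed_sdiff_lt (measure_ne_top m _) hε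
    refine ⟨A ×ˢ K, Set.prod_mono_right hKB, hA.prod hK.measurableSet, fun y => ?_, fun y => ?_⟩
    · by_cases hy : y ∈ A <;> simp [hy, hK]
    · refine (measure_mono fun z hz => ?_).trans hK'.le
      exact ⟨hz.1.2, fun h => hz.2 ⟨hz.1.1, h⟩⟩
  · intro ε hε
    obtain ⟨K, hKB, hK, hK'⟩ := hB.compl.exists_isClosed_sdiff_lt (measure_ne_top m _) hε
    refine ⟨Aᶜ ×ˢ Set.univ ∪ Set.univ ×ˢ K, ?_, ?_, fun y => ?_, fun y => ?_⟩
    · rintro ⟨y, z⟩ (h | h) h'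
      · exact h.1 h'.1
      · exact hKB h.2 h'.2
    · exact (hA.compl.prod MeasurableSet.univ).union (MeasurableSet.univ.prod hK.measurableSet)
    · by_cases hy : y ∈ A <;> simp [hy, hK]
    · refine (measure_mono fun z hz => ?_).trans hK'.le
      refine ⟨fun hz' => ?_, fun h => hz.2 (Or.inr ⟨trivial, h⟩)⟩
      refine hz.2 (Or.inl ⟨fun hy => hz.1 ⟨hy, hz'⟩, trivial⟩)

lemma MeasurableSet.closedApprox [IsFiniteMeasure m] {E : Set (Y × ℝ)} (hE : MeasurableSet E) :
    ClosedApprox m E := by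
  refine (MeasurableSpace.induction_on_inter
    (C := fun E _ => ClosedApprox m E ∧ ClosedApprox m Eᶜ) generateFrom_prod.symm isPiSystem_prod
    ?_ ?_ ?_ ?_ E hE).1
  · have := closedApprox_rectangle (Y := Y) (m := m) MeasurableSet.empty MeasurableSet.empty
    simpa using this
  · rintro _ ⟨A, hA, B, hB, rfl⟩
    exact closedApprox_rectangle hA hB
  · intro t _ h
    rw [compl_compl]
    exact h.symm
  · intro t _ htm h
    refine ⟨ClosedApprox.iUnion htm fun n => (h n).1, ?_⟩
    rw [Set.compl_iUnion]
    exact ClosedApprox.iInter fun n => (h n).2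

/-- If the sections of `F` are closed, bounded below and of positive measure, then the least point
of the support of `m` restricted to the section is a measurable selection. -/
lemma exists_measurable_selection_of_isClosed [IsFiniteMeasure m] (hm : m (Set.Iic 0) = 0)
    {F : Set (Y × ℝ)} (hF : MeasurableSet F) (hFc : ∀ y, IsClosed (Prod.mk y ⁻¹' F))
    (hpos : ∀ y, 0 < m (Prod.mk y ⁻¹' F)) :
    ∃ s : Y → ℝ, Measurable s ∧ ∀ y, (y, s y) ∈ F := by
  set T : Y → Set ℝ := fun y => {t | 0 < m (Prod.mk y ⁻¹' F ∩ Set.Iic t)} with hT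
  have hup : ∀ y t t', t ∈ T y → t ≤ t' → t' ∈ T y := fun y t t' ht htt' =>
    lt_of_lt_of_le ht (measure_mono (Set.inter_subset_inter_right _ (Set.Iic_subset_Iic.2 htt')))
  have hbdd : ∀ y, BddBelow (T y) := by
    refine fun y => ⟨0, fun t ht => ?_⟩
    by_contra hlt
    have : m (Prod.mk y ⁻¹' F ∩ Set.Iic t) ≤ m (Set.Iic 0) :=
      measure_mono (Set.inter_subset_right.trans (Set.Iic_subset_Iic.2 (not_le.1 hlt).le))
    rw [hm] at this
    exact absurd ht (not_lt.2 this)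
  have hne : ∀ y, (T y).Nonempty := by
    intro y
    by_contra hempty
    have h0 : ∀ n : ℕ, m (Prod.mk y ⁻¹' F ∩ Set.Iic (n : ℝ)) = 0 := fun n => by
      by_contra h
      exact hempty ⟨n, pos_iff_ne_zero.2 h⟩
    have h1 : Prod.mk y ⁻¹' F = ⋃ n : ℕ, Prod.mk y ⁻¹' F ∩ Set.Iic (n : ℝ) := by
      rw [← Set.inter_iUnion]
      refine (Set.inter_eq_left.2 fun z _ => ?_).symm
      obtain ⟨n, hn⟩ := exists_nat_ge z
      exact Set.mem_iUnion.2 ⟨n, hn⟩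
    have := hpos y
    rw [h1, measure_iUnion_null h0] at this
    exact lt_irrefl _ this
  refine ⟨fun y => sInf (T y), ?_, fun y => ?_⟩
  · refine measurable_of_Iio fun a => ?_
    have : (fun y => sInf (T y)) ⁻¹' Set.Iio a
        = ⋃ q : ℚ, ⋃ _ : (q : ℝ) < a,
          {y | 0 < m (Prod.mk y ⁻¹' (F ∩ Set.univ ×ˢ Set.Iic (q : ℝ)))} := by
      ext y
      simp only [Set.mem_preimage, Set.mem_Iio, Set.mem_iUnion, exists_prop]
      rw [csInf_lt_iff (hbdd y) (hne y)]
      constructor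
      · rintro ⟨t, ht, hta⟩
        obtain ⟨q, hq, hqa⟩ := exists_rat_btwn hta
        refine ⟨q, hqa, ?_⟩
        have := hup y t q ht hq.le
        simpa [hT, Set.preimage_inter, Set.mk_preimage_prod_right] using this
      · rintro ⟨q, hqa, hq⟩
        refine ⟨q, ?_, hqa⟩
        simpa [hT, Set.preimage_inter, Set.mk_preimage_prod_right] using hq
    rw [this]
    refine MeasurableSet.iUnion fun q => MeasurableSet.iUnion fun _ => ?_
    exact measurableSet_lt measurable_const (measurable_measure_prodMk_left
      (hF.inter (MeasurableSet.univ.prod measurableSet_Iic)))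
  · by_contra hnot
    have hnhds : (Prod.mk y ⁻¹' F)ᶜ ∈ nhds (sInf (T y)) := (hFc y).isOpen_compl.mem_nhds hnot
    obtain ⟨δ, hδ, hball⟩ := Metric.mem_nhds_iff.1 hnhds
    obtain ⟨t, ht, htlt⟩ := exists_lt_of_csInf_lt (hne y) (lt_add_of_pos_right (sInf (T y)) hδ)
    have hmem : sInf (T y) - δ ∈ T y := by
      refine lt_of_lt_of_le ht (measure_mono ?_)
      rintro z ⟨hz, hzt⟩
      refine ⟨hz, ?_⟩
      by_contra hlt
      have hzt : z ≤ t := hzt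
      refine hball ?_ hz
      rw [Metric.mem_ball, Real.dist_eq, abs_lt]
      simp only [Set.mem_Iic, not_le] at hlt
      constructor <;> linarith
    have := csInf_le (hbdd y) hmem
    linarith

/-- A measurable set whose sections have measure bounded below admits a measurable selection. -/
lemma exists_measurable_selection {Z : Type*} [MeasurableSpace Z] [StandardBorelSpace Z]
    (m : Measure Z) [IsFiniteMeasure m] {E : Set (Y × Z)} (hE : MeasurableSet E) {c : ℝ≥0∞}
    (hc : c ≠ 0) (hpos : ∀ y, c ≤ m (Prod.mk y ⁻¹' E)) :
    ∃ s : Y → Z, Measurable s ∧ ∀ y, (y, s y) ∈ E := by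
  -- embed `Z` into the positive half-line
  have he : MeasurableEmbedding fun z : Z => Real.exp (embeddingReal Z z) :=
    (Real.measurable_exp.comp (measurableEmbedding_embeddingReal Z).measurable).measurableEmbedding
      (Real.exp_injective.comp (measurableEmbedding_embeddingReal Z).injective)
  set e : Z → ℝ := fun z => Real.exp (embeddingReal Z z) with he_def
  have hpe : MeasurableEmbedding (Prod.map id e : Y × Z → Y × ℝ) :=
    MeasurableEmbedding.id.prodMap he
  have hm0 : (m.map e) (Set.Iic 0) = 0 := by
    rw [he.map_apply]
    have : e ⁻¹' Set.Iic 0 = ∅ := Set.eq_empty_of_forall_notMem fun z hz =>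
      absurd (Real.exp_pos (embeddingReal Z z)) (not_lt.2 hz)
    rw [this, measure_empty]
  have hsec : ∀ y, (m.map e) (Prod.mk y ⁻¹' (Prod.map id e '' E)) = m (Prod.mk y ⁻¹' E) := by
    intro y
    rw [he.map_apply]
    congr 1
    ext z
    constructor
    · rintro ⟨⟨y', z'⟩, hz, h⟩
      obtain ⟨rfl, h2⟩ := Prod.mk.inj h
      obtain rfl := he.injective h2
      exact hz
    · exact fun hz => ⟨(y, z), hz, rfl⟩
  obtain ⟨c', hc', hcc'⟩ := exists_between (pos_iff_ne_zero.2 hc)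
  obtain ⟨F, hFE, hFm, hFc, hF⟩ := MeasurableSet.closedApprox (m := m.map e)
    (hpe.measurableSet_image.2 hE) c' hc'.ne'
  obtain ⟨s, hs, hsF⟩ := exists_measurable_selection_of_isClosed hm0 hFm hFc fun y => by
    by_contra h0
    have h0 : (m.map e) (Prod.mk y ⁻¹' F) = 0 := by simpa using h0
    have h1 : c ≤ c' := by
      calc c ≤ (m.map e) (Prod.mk y ⁻¹' (Prod.map id e '' E)) := (hsec y).symm ▸ hpos y
        _ ≤ (m.map e) (Prod.mk y ⁻¹' F ∪ Prod.mk y ⁻¹' (Prod.map id e '' E \ F)) := by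
          refine measure_mono fun z hz => ?_
          by_cases h : (y, z) ∈ F
          · exact Or.inl h
          · exact Or.inr ⟨hz, h⟩
        _ ≤ 0 + c' := (measure_union_le _ _).trans (add_le_add h0.le (hF y))
        _ = c' := zero_add _
    exact absurd hcc' (not_lt.2 h1)
  have hsE : ∀ y, ∃ z, (y, z) ∈ E ∧ e z = s y := by
    intro y
    obtain ⟨⟨y', z⟩, hz, h⟩ := hFE (hsF y)
    obtain ⟨rfl, h2⟩ := Prod.mk.inj h
    exact ⟨z, hz, h2⟩
  choose z hz hzs using hsE
  refine ⟨z, he.measurable_comp_iff.1 ?_, hz⟩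
  have : e ∘ z = s := funext hzs
  rw [this]
  exact hs

end selection

/-! ### Homogeneous cochains and subdivision -/

section subdivision

universe u

variable {X : Type u}

/-- The coboundary of functions of `n` points, in the augmented homogeneous complex: `n = 0` is
allowed. -/
def cob {n : ℕ} (f : (Fin n → X) → ℝ) : (Fin (n + 1) → X) → ℝ :=
  fun g => ∑ i : Fin (n + 1), (-1) ^ (i : ℕ) * f (g ∘ i.succAbove)

/-- The restriction of a cochain to the simplices with first vertex `y`. -/
def atApex {n : ℕ} (y : X) (f : (Fin (n + 1) → X) → ℝ) : (Fin n → X) → ℝ :=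
  fun x => f (Fin.cons y x : Fin (n + 1) → X)

lemma cob_sub {n : ℕ} (f f' : (Fin n → X) → ℝ) : cob (f - f') = cob f - cob f' := by
  funext g
  simp [cob, mul_sub]

lemma cob_smul {n : ℕ} (c : ℝ) (f : (Fin n → X) → ℝ) : cob (c • f) = c • cob f := by
  funext g
  simp only [cob, Pi.smul_apply, smul_eq_mul, Finset.mul_sum]
  exact Finset.sum_congr rfl fun _ _ => mul_left_comm _ _ _

lemma cob_zero {n : ℕ} : cob (0 : (Fin n → X) → ℝ) = 0 := by
  funext g
  simp [cob]

lemma cob_comp {n : ℕ} (φ : X → X) (f : (Fin n → X) → ℝ) (g : Fin (n + 1) → X) :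
    cob f (φ ∘ g) = cob (fun x => f (φ ∘ x)) g := rfl

lemma atApex_cob {n : ℕ} (y : X) (f : (Fin (n + 1) → X) → ℝ) :
    atApex y (cob f) = f - cob (atApex y f) := by
  funext x
  have h0 : (Fin.cons y x : Fin (n + 2) → X) ∘ (0 : Fin (n + 2)).succAbove = x := by
    funext k
    simp
  have h1 : ∀ i : Fin (n + 1), (Fin.cons y x : Fin (n + 2) → X) ∘ i.succ.succAbove
      = Fin.cons y (x ∘ i.succAbove) := by
    intro i
    funext k
    refine Fin.cases ?_ (fun k => ?_) k <;> simp
  simp only [atApex, cob, Pi.sub_apply]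
  rw [Fin.sum_univ_succ, h0]
  simp only [h1, Fin.val_zero, pow_zero, one_mul, Fin.val_succ, pow_succ, mul_neg, mul_one,
    neg_mul, Finset.sum_neg_distrib, sub_eq_add_neg]

lemma atApex_cob_of_zero (y : X) (f : (Fin 0 → X) → ℝ) : atApex y (cob f) = f := by
  funext x
  simp only [atApex, cob]
  rw [Subsingleton.elim x ((Fin.cons y x : Fin 1 → X) ∘ Fin.succAbove default)]
  simp

lemma cob_cob : ∀ {n : ℕ} (f : (Fin n → X) → ℝ), cob (cob f) = 0
  | 0, f => by
    funext g
    rw [← Fin.cons_self_tail g]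
    change atApex (g 0) (cob (cob f)) _ = 0
    rw [atApex_cob, atApex_cob_of_zero, sub_self]
    rfl
  | n + 1, f => by
    funext g
    rw [← Fin.cons_self_tail g]
    change atApex (g 0) (cob (cob f)) _ = 0
    rw [atApex_cob, atApex_cob, cob_sub, cob_cob (atApex (g 0) f), sub_zero, sub_self]
    rfl

/-- A choice of an additional vertex, the apex, for each nondegenerate or degenerate simplex with
vertices in `X`. -/
abbrev Apex (X : Type u) : Type u := (n : ℕ) → (Fin (n + 1) → X) → X

/-- Subdivision of simplices, dually: the subdivision of `g` is the cone, with vertex the apex of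
`g`, over the subdivision of the boundary of `g`. For barycenters as apices this is barycentric
subdivision. -/
def subdiv (y : Apex X) : (n : ℕ) → ((Fin n → X) → ℝ) → (Fin n → X) → ℝ
  | 0, f => f
  | n + 1, f => fun g => cob (subdiv y n (atApex (y n g) f)) g

/-- The chain homotopy between the identity and subdivision, dually. -/
def subdivHtpy (y : Apex X) : (n : ℕ) → ((Fin (n + 1) → X) → ℝ) → (Fin n → X) → ℝ
  | 0, _ => 0
  | n + 1, f => fun g => atApex (y n g) f g - subdiv y (n + 1) (atApex (y n g) f) g
      - cob (subdivHtpy y n (atApex (y n g) f)) g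

variable (y : Apex X)

lemma subdiv_sub : ∀ {n : ℕ} (f f' : (Fin n → X) → ℝ),
    subdiv y n (f - f') = subdiv y n f - subdiv y n f'
  | 0, _, _ => rfl
  | n + 1, f, f' => by
    funext g
    change cob (subdiv y n (atApex (y n g) f - atApex (y n g) f')) g = _
    rw [subdiv_sub, cob_sub]
    rfl

lemma subdiv_smul (c : ℝ) : ∀ {n : ℕ} (f : (Fin n → X) → ℝ),
    subdiv y n (c • f) = c • subdiv y n f
  | 0, _ => rfl
  | n + 1, f => by
    funext g
    change cob (subdiv y n (c • atApex (y n g) f)) g = _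
    rw [subdiv_smul, cob_smul]
    rfl

lemma subdivHtpy_sub : ∀ {n : ℕ} (f f' : (Fin (n + 1) → X) → ℝ),
    subdivHtpy y n (f - f') = subdivHtpy y n f - subdivHtpy y n f'
  | 0, _, _ => (sub_zero 0).symm
  | n + 1, f, f' => by
    funext g
    change (atApex (y n g) f - atApex (y n g) f') g
      - subdiv y (n + 1) (atApex (y n g) f - atApex (y n g) f') g
      - cob (subdivHtpy y n (atApex (y n g) f - atApex (y n g) f')) g = _
    rw [subdivHtpy_sub, cob_sub, subdiv_sub]
    simp only [subdivHtpy, Pi.sub_apply]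
    ring

lemma subdivHtpy_smul (c : ℝ) : ∀ {n : ℕ} (f : (Fin (n + 1) → X) → ℝ),
    subdivHtpy y n (c • f) = c • subdivHtpy y n f
  | 0, _ => (smul_zero c).symm
  | n + 1, f => by
    funext g
    change (c • atApex (y n g) f) g - subdiv y (n + 1) (c • atApex (y n g) f) g
      - cob (subdivHtpy y n (c • atApex (y n g) f)) g = _
    rw [subdivHtpy_smul, cob_smul, subdiv_smul]
    simp only [subdivHtpy, Pi.smul_apply, smul_eq_mul]
    ring

lemma subdiv_cob : ∀ {n : ℕ} (f : (Fin n → X) → ℝ),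
    subdiv y (n + 1) (cob f) = cob (subdiv y n f)
  | 0, f => by
    funext g
    change cob (subdiv y 0 (atApex (y 0 g) (cob f))) g = _
    rw [atApex_cob_of_zero]
  | n + 1, f => by
    funext g
    change cob (subdiv y (n + 1) (atApex (y (n + 1) g) (cob f))) g = _
    rw [atApex_cob, subdiv_sub, subdiv_cob, cob_sub, cob_cob, sub_zero]

lemma sub_subdiv_zero (f : (Fin 0 → X) → ℝ) : f - subdiv y 0 f = subdivHtpy y 0 (cob f) :=
  sub_self f

lemma sub_subdiv : ∀ {n : ℕ} (f : (Fin (n + 1) → X) → ℝ),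
    f - subdiv y (n + 1) f = subdivHtpy y (n + 1) (cob f) + cob (subdivHtpy y n f) := by
  -- the homotopy identity in degree `n`, up to a coboundary, gives the one in degree `n + 1`
  have step : ∀ {n : ℕ}, (∀ u : (Fin n → X) → ℝ,
      cob (u - subdiv y n u - subdivHtpy y n (cob u)) = 0) → ∀ f : (Fin (n + 1) → X) → ℝ,
      f - subdiv y (n + 1) f = subdivHtpy y (n + 1) (cob f) + cob (subdivHtpy y n f) := by
    intro n key f
    funext g
    have h := congrFun (key (atApex (y n g) f)) g
    rw [cob_sub, cob_sub, ← subdiv_cob] at h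
    change f g - subdiv y (n + 1) f g
      = atApex (y n g) (cob f) g - subdiv y (n + 1) (atApex (y n g) (cob f)) g
        - cob (subdivHtpy y n (atApex (y n g) (cob f))) g + cob (subdivHtpy y n f) g
    rw [atApex_cob, subdiv_sub, subdivHtpy_sub, cob_sub]
    simp only [Pi.sub_apply, Pi.zero_apply] at h ⊢
    linarith
  intro n
  induction n with
  | zero => exact step fun u => by rw [sub_subdiv_zero, sub_self, cob_zero]
  | succ n ih => exact step fun u => by rw [ih, add_sub_cancel_left, cob_cob]

/-- Subdivision does not change the class of a cocycle. -/
lemma eq_subdiv_add_cob {n : ℕ} {f : (Fin (n + 1) → X) → ℝ} (hf : cob f = 0) :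
    f = subdiv y (n + 1) f + cob (subdivHtpy y n f) := by
  have h := sub_subdiv y f
  have h0 : subdivHtpy y (n + 1) (0 : (Fin (n + 2) → X) → ℝ) = 0 := by
    simpa using subdivHtpy_smul y 0 (0 : (Fin (n + 2) → X) → ℝ)
  rw [hf, h0, zero_add] at h
  rw [← h, add_sub_cancel]

lemma subdiv_comp {φ : X → X} (hφ : ∀ n g, y n (φ ∘ g) = φ (y n g)) :
    ∀ {n : ℕ} (f : (Fin n → X) → ℝ) (g : Fin n → X),
      subdiv y n f (φ ∘ g) = subdiv y n (fun x => f (φ ∘ x)) g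
  | 0, _, _ => rfl
  | n + 1, f, g => by
    change cob (subdiv y n (atApex (y n (φ ∘ g)) f)) (φ ∘ g)
      = cob (subdiv y n (atApex (y n g) fun x => f (φ ∘ x))) g
    rw [cob_comp, hφ]
    congr 1
    funext x
    rw [subdiv_comp hφ]
    congr 1
    funext x
    exact congrArg f (Fin.comp_cons φ _ _).symm

lemma subdivHtpy_comp {φ : X → X} (hφ : ∀ n g, y n (φ ∘ g) = φ (y n g)) :
    ∀ {n : ℕ} (f : (Fin (n + 1) → X) → ℝ) (g : Fin n → X),
      subdivHtpy y n f (φ ∘ g) = subdivHtpy y n (fun x => f (φ ∘ x)) g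
  | 0, _, _ => rfl
  | n + 1, f, g => by
    have h : (fun x => atApex (y n (φ ∘ g)) f (φ ∘ x))
        = atApex (y n g) fun x => f (φ ∘ x) := by
      funext x
      rw [hφ]
      exact congrArg f (Fin.comp_cons φ _ _).symm
    simp only [subdivHtpy]
    rw [subdiv_comp y hφ, cob_comp, h, ← h]
    congr 2
    funext x
    exact subdivHtpy_comp hφ _ _

/-- The simplices `g` such that all the top-dimensional simplices of the subdivision of `g` are
in `Q`. -/
def onFlags (y : Apex X) : (n : ℕ) → Set (Fin n → X) → Set (Fin n → X)
  | 0, Q => Q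
  | n + 1, Q => {g | ∀ i : Fin (n + 1),
      g ∘ i.succAbove ∈ onFlags y n {x | (Fin.cons (y n g) x : Fin (n + 1) → X) ∈ Q}}

lemma onFlags_congr {y y' : Apex X} : ∀ {n : ℕ}, (∀ k < n, y k = y' k) →
    ∀ Q : Set (Fin n → X), onFlags y n Q = onFlags y' n Q
  | 0, _, _ => rfl
  | n + 1, h, Q => by
    ext g
    simp only [onFlags, Set.mem_ofPred_eq]
    rw [h n n.lt_succ_self]
    refine forall_congr' fun i => ?_
    rw [onFlags_congr fun k hk => h k (hk.trans n.lt_succ_self)]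

lemma comp_mem_onFlags {φ : X → X} (hφ : ∀ n g, y n (φ ∘ g) = φ (y n g)) :
    ∀ {n : ℕ} (Q : Set (Fin n → X)) (g : Fin n → X),
      φ ∘ g ∈ onFlags y n Q ↔ g ∈ onFlags y n {x | φ ∘ x ∈ Q}
  | 0, _, _ => Iff.rfl
  | n + 1, Q, g => by
    simp only [onFlags, Set.mem_ofPred_eq]
    refine forall_congr' fun i => ?_
    rw [Function.comp_assoc, comp_mem_onFlags hφ, hφ]
    simp only [Set.mem_ofPred_eq, Fin.comp_cons]

lemma abs_subdiv_le {N : ℝ} : ∀ {n : ℕ} {Q : Set (Fin n → X)} {f : (Fin n → X) → ℝ}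
    (_ : ∀ x ∈ Q, |f x| ≤ N) {g : Fin n → X} (_ : g ∈ onFlags y n Q),
    |subdiv y n f g| ≤ n.factorial * N
  | 0, _, _, hf, _, hg => by
    rw [Nat.factorial_zero, Nat.cast_one, one_mul]
    exact hf _ hg
  | n + 1, Q, f, hf, g, hg => by
    have h : ∀ i : Fin (n + 1), |subdiv y n (atApex (y n g) f) (g ∘ i.succAbove)|
        ≤ n.factorial * N := fun i =>
      abs_subdiv_le (f := atApex (y n g) f) (fun x hx => hf (Fin.cons (y n g) x) hx) (hg i)
    calc |subdiv y (n + 1) f g|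
        ≤ ∑ i : Fin (n + 1),
          |(-1) ^ (i : ℕ) * subdiv y n (atApex (y n g) f) (g ∘ i.succAbove)| :=
        Finset.abs_sum_le_sum_abs
          (fun i : Fin (n + 1) => (-1) ^ (i : ℕ) * subdiv y n (atApex (y n g) f) (g ∘ i.succAbove))
          Finset.univ
      _ ≤ ∑ _i : Fin (n + 1), n.factorial * N := by
        refine Finset.sum_le_sum fun i _ => ?_
        rw [abs_mul, abs_pow, abs_neg, abs_one, one_pow, one_mul]
        exact h i
      _ = (n + 1).factorial * N := by
        rw [Finset.sum_const, Finset.card_univ, Fintype.card_fin, nsmul_eq_mul,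
          Nat.factorial_succ]
        push_cast
        ring

section measurability

variable [MeasurableSpace X]

lemma measurable_cons {W : Type*} [MeasurableSpace W] {n : ℕ} {a : W → X} {b : W → Fin n → X}
    (ha : Measurable a) (hb : Measurable b) :
    Measurable fun w => (Fin.cons (a w) (b w) : Fin (n + 1) → X) := by
  refine measurable_pi_lambda _ fun k => ?_
  refine Fin.cases ?_ (fun k => ?_) k
  · simpa using ha
  · simpa using (measurable_pi_iff.1 hb) k

lemma measurable_comp_succAbove {n : ℕ} (i : Fin (n + 1)) :
    Measurable fun g : Fin (n + 1) → X => g ∘ i.succAbove :=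
  measurable_pi_lambda _ fun _ => measurable_pi_apply _

variable {W : Type u} [MeasurableSpace W]

lemma measurable_cob {n : ℕ} {F : W × (Fin n → X) → ℝ} (hF : Measurable F) :
    Measurable fun p : W × (Fin (n + 1) → X) => cob (fun x => F (p.1, x)) p.2 :=
  Finset.measurable_sum _ fun i _ => measurable_const.mul <|
    hF.comp (measurable_fst.prodMk ((measurable_comp_succAbove i).comp measurable_snd))

lemma measurable_atApex {y : Apex X} (hy : ∀ n, Measurable (y n)) {k n : ℕ}
    {F : W × (Fin (n + 1) → X) → ℝ} (hF : Measurable F) :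
    Measurable fun p : (W × (Fin (k + 1) → X)) × (Fin n → X) =>
      atApex (y k p.1.2) (fun x => F (p.1.1, x)) p.2 :=
  hF.comp ((measurable_fst.comp measurable_fst).prodMk (measurable_cons
    ((hy k).comp (measurable_snd.comp measurable_fst)) measurable_snd))

/-- Restriction to the diagonal in the parameter space. -/
lemma measurable_diag {n : ℕ} {F : (W × (Fin n → X)) × (Fin n → X) → ℝ} (hF : Measurable F) :
    Measurable fun p : W × (Fin n → X) => F (p, p.2) :=
  hF.comp (measurable_id.prodMk measurable_snd)

/-- The subdivision of a cochain that depends measurably on a parameter. The parameter takes the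
apices in the recursive definition. -/
lemma measurable_subdiv {y : Apex X} (hy : ∀ n, Measurable (y n)) :
    ∀ {n : ℕ} {W : Type u} [MeasurableSpace W] {F : W × (Fin n → X) → ℝ} (_ : Measurable F),
      Measurable fun p : W × (Fin n → X) => subdiv y n (fun x => F (p.1, x)) p.2
  | 0, _, _, _, hF => hF
  | _ + 1, _, _, _, hF =>
    measurable_diag (measurable_cob (measurable_subdiv hy (measurable_atApex hy hF)))

lemma measurable_subdivHtpy {y : Apex X} (hy : ∀ n, Measurable (y n)) :
    ∀ {n : ℕ} {W : Type u} [MeasurableSpace W] {F : W × (Fin (n + 1) → X) → ℝ} (_ : Measurable F),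
      Measurable fun p : W × (Fin n → X) => subdivHtpy y n (fun x => F (p.1, x)) p.2
  | 0, _, _, _, _ => measurable_const
  | n + 1, W, _, F, hF => by
    have h1 := measurable_diag (measurable_atApex (k := n) hy hF)
    have h2 := measurable_diag (measurable_subdiv hy (measurable_atApex (k := n) hy hF))
    have h3 := measurable_diag (measurable_cob (measurable_subdivHtpy (n := n) hy
      (F := fun p : (W × (Fin (n + 1) → X)) × (Fin (n + 1) → X) =>
        atApex (y n p.1.2) (fun x => F (p.1.1, x)) p.2) (measurable_atApex hy hF)))
    exact (h1.sub h2).sub h3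

lemma measurableSet_onFlags {y : Apex X} (hy : ∀ n, Measurable (y n)) :
    ∀ {n : ℕ} {W : Type u} [MeasurableSpace W] {Q : Set (W × (Fin n → X))} (_ : MeasurableSet Q),
      MeasurableSet {p : W × (Fin n → X) | p.2 ∈ onFlags y n {x | (p.1, x) ∈ Q}}
  | 0, _, _, _, hQ => hQ
  | n + 1, W, _, Q, hQ => by
    have hQ' : MeasurableSet {p : (W × (Fin (n + 1) → X)) × (Fin n → X) |
        (p.1.1, (Fin.cons (y n p.1.2) p.2 : Fin (n + 1) → X)) ∈ Q} :=
      ((measurable_fst.comp measurable_fst).prodMk (measurable_cons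
        ((hy n).comp (measurable_snd.comp measurable_fst)) measurable_snd)) hQ
    have h := measurableSet_onFlags hy hQ'
    have : {p : W × (Fin (n + 1) → X) | p.2 ∈ onFlags y (n + 1) {x | (p.1, x) ∈ Q}}
        = ⋂ i : Fin (n + 1), (fun p => (p, p.2 ∘ i.succAbove)) ⁻¹'
          {p : (W × (Fin (n + 1) → X)) × (Fin n → X) | p.2 ∈ onFlags y n
            {x | (p.1.1, (Fin.cons (y n p.1.2) x : Fin (n + 1) → X)) ∈ Q}} := by
      ext p
      simp [onFlags]
    rw [this]
    exact MeasurableSet.iInter fun i =>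
      (measurable_id.prodMk ((measurable_comp_succAbove i).comp measurable_snd)) h

end measurability

/-- Since a simplex of dimension `n - 1` has `n!` flags, the estimate for one simplex gives an
estimate for all the simplices of the subdivision at once. -/
lemma measure_notMem_onFlags_le {Z : Type*} [MeasurableSpace Z] (m : Measure Z) {ε : ℝ≥0∞} :
    ∀ {n : ℕ} (Q : Z → Set (Fin n → X)) {g : Fin n → X}
      (_ : g ∈ onFlags y n {x | m {z | x ∉ Q z} ≤ ε}),
      m {z | g ∉ onFlags y n (Q z)} ≤ n.factorial * ε
  | 0, Q, g, hg => by
    rw [Nat.factorial_zero, Nat.cast_one, one_mul]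
    exact hg
  | n + 1, Q, g, hg => by
    have h : ∀ i : Fin (n + 1), m {z | g ∘ i.succAbove ∉ onFlags y n
        {x | (Fin.cons (y n g) x : Fin (n + 1) → X) ∈ Q z}} ≤ n.factorial * ε := fun i =>
      measure_notMem_onFlags_le m
        (fun z => {x | (Fin.cons (y n g) x : Fin (n + 1) → X) ∈ Q z}) (hg i)
    calc m {z | g ∉ onFlags y (n + 1) (Q z)}
        ≤ m (⋃ i : Fin (n + 1), {z | g ∘ i.succAbove ∉ onFlags y n
            {x | (Fin.cons (y n g) x : Fin (n + 1) → X) ∈ Q z}}) := by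
          refine measure_mono fun z hz => ?_
          by_contra h'
          simp only [Set.mem_iUnion, not_exists, Set.mem_ofPred_eq, not_not] at h'
          exact hz h'
      _ ≤ ∑ i : Fin (n + 1), m {z | g ∘ i.succAbove ∉ onFlags y n
            {x | (Fin.cons (y n g) x : Fin (n + 1) → X) ∈ Q z}} := measure_iUnion_fintype_le _ _
      _ ≤ ∑ _i : Fin (n + 1), n.factorial * ε := Finset.sum_le_sum fun i _ => h i
      _ = (n + 1).factorial * ε := by
        rw [Finset.sum_const, Finset.card_univ, Fintype.card_fin, nsmul_eq_mul,
          Nat.factorial_succ]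
        push_cast
        ring

end subdivision

/-! ### Generic apices -/

section apices

variable {G : Type*} [Group G] {H : Subgroup G}

/-- The left translates of a set of tuples by the elements of `H` are contained in the set. -/
def IsInvariant (H : Subgroup G) {n : ℕ} (Q : Set (Fin n → G)) : Prop :=
  ∀ h ∈ H, ∀ x ∈ Q, (h * ·) ∘ x ∈ Q

lemma IsInvariant.mem_iff {n : ℕ} {Q : Set (Fin n → G)} (hQ : IsInvariant H Q) {h : G}
    (hh : h ∈ H) (x : Fin n → G) : (h * ·) ∘ x ∈ Q ↔ x ∈ Q := by
  refine ⟨fun hx => ?_, hQ h hh x⟩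
  convert hQ h⁻¹ (H.inv_mem hh) _ hx using 1
  funext i
  simp

variable [MeasurableSpace G] (m : Measure H)

/-- The `n`-tuples to which almost all elements of `H` can be prepended without leaving `Q`. The
exceptional set is allowed to have so small a measure that the exceptional sets of `(n + 1)!`
tuples together do not fill more than half of `H`. -/
def core {n : ℕ} (Q : Set (Fin (n + 1) → G)) : Set (Fin n → G) :=
  {x | m {h : H | (Fin.cons (h : G) x : Fin (n + 1) → G) ∉ Q} ≤ (2 * ((n + 1).factorial : ℝ≥0∞))⁻¹}

/-- The iterated core of a set of tuples is not empty: starting from the empty tuple, almost all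
elements of `H` can be prepended in each step. -/
def IsLarge : (n : ℕ) → Set (Fin n → G) → Prop
  | 0, Q => Fin.elim0 ∈ Q
  | n + 1, Q => IsLarge n (core m Q)

lemma measurableSet_prepend {n : ℕ} {Q : Set (Fin (n + 1) → G)} (hQ : MeasurableSet Q) :
    MeasurableSet {p : (Fin n → G) × H | (Fin.cons (p.2 : G) p.1 : Fin (n + 1) → G) ∈ Q} :=
  measurable_cons (measurable_subtype_coe.comp measurable_snd) measurable_fst hQ

lemma measurableSet_core [SFinite m] {n : ℕ} {Q : Set (Fin (n + 1) → G)} (hQ : MeasurableSet Q) :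
    MeasurableSet (core m Q) :=
  measurableSet_le (measurable_measure_prodMk_left (measurableSet_prepend hQ).compl)
    measurable_const

/-- In an increasing exhaustion, some set is large. -/
lemma exists_isLarge [IsFiniteMeasure m] : ∀ {n : ℕ} {Q : ℕ → Set (Fin n → G)}
    (_ : ∀ N, MeasurableSet (Q N)) (_ : Monotone Q) (_ : ∀ x, ∃ N, x ∈ Q N),
    ∃ N, IsLarge m n (Q N)
  | 0, _, _, _, h => h _
  | n + 1, Q, hQ, hmono, h => by
    refine exists_isLarge (Q := fun N => core m (Q N)) (fun N => measurableSet_core m (hQ N)) ?_ ?_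
    · exact fun N M hNM x hx => le_trans (measure_mono
        fun (z : H) (hz : (Fin.cons (z : G) x : Fin (n + 1) → G) ∉ Q M) hz' =>
          hz (hmono hNM hz')) hx
    · intro x
      have h1 := tendsto_measure_iInter_atTop (μ := m)
        (s := fun N => {z : H | (Fin.cons (z : G) x : Fin (n + 1) → G) ∉ Q N})
        (fun N => (measurable_prodMk_left
          (measurableSet_prepend (H := H) (hQ N)).compl).nullMeasurableSet)
        (fun N M hNM z hz hz' => hz (hmono hNM hz')) ⟨0, measure_ne_top _ _⟩
      have h2 : ⋂ N, {z : H | (Fin.cons (z : G) x : Fin (n + 1) → G) ∉ Q N} = ∅ := by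
        refine Set.eq_empty_of_forall_notMem fun z hz => ?_
        obtain ⟨N, hN⟩ := h (Fin.cons (z : G) x)
        exact Set.mem_iInter.1 hz N hN
      rw [h2, measure_empty] at h1
      obtain ⟨N, hN⟩ := ((tendsto_order.1 h1).2 (2 * ((n + 1).factorial : ℝ≥0∞))⁻¹
        (ENNReal.inv_pos.2 (ENNReal.mul_ne_top (by simp) (by simp)))).exists
      exact ⟨N, hN.le⟩

lemma IsInvariant.core [MeasurableMul H] [m.IsMulLeftInvariant] {n : ℕ}
    {Q : Set (Fin (n + 1) → G)} (hQ : IsInvariant H Q) : IsInvariant H (core m Q) := by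
  intro h hh x hx
  refine le_of_eq_of_le ?_ (show m {z : H |
    (Fin.cons (z : G) x : Fin (n + 1) → G) ∉ Q} ≤ _ from hx)
  rw [← measure_preimage_mul m (⟨h, hh⟩ : H)]
  congr 1
  ext z
  change Fin.cons (h * (z : G)) ((h * ·) ∘ x) ∉ Q ↔ _
  rw [← Fin.comp_cons (h * ·) (z : G) x, hQ.mem_iff hh]
  rfl

/-- If `Q` is large, there is an `H`-equivariant measurable choice of apices such that all the
simplices of all subdivisions are in `Q`. -/
lemma exists_apex [StandardBorelSpace H] [MeasurableMul H] [MeasurableMul₂ G] [MeasurableInv G]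
    [IsProbabilityMeasure m] [m.IsMulLeftInvariant] {r : G → H} (hr : Measurable r)
    (hr' : ∀ (h : H) g, r (h * g) = h * r g) :
    ∀ {n : ℕ} {Q : Set (Fin n → G)} (_ : MeasurableSet Q) (_ : IsInvariant H Q)
      (_ : IsLarge m n Q),
      ∃ y : Apex G, (∀ k, Measurable (y k)) ∧ (∀ h ∈ H, ∀ k g, y k ((h * ·) ∘ g) = h * y k g) ∧
        ∀ g, g ∈ onFlags y n Q
  | 0, _, _, _, hlarge => by
    refine ⟨fun k g => g 0, fun k => measurable_pi_apply 0, fun _ _ _ _ => rfl, fun g => ?_⟩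
    rw [Subsingleton.elim g Fin.elim0]
    exact hlarge
  | n + 1, Q, hQ, hinv, hlarge => by
    classical
    obtain ⟨y, hy, hyH, hyQ⟩ := exists_apex hr hr' (measurableSet_core m hQ) (hinv.core m) hlarge
    set E : Set ((Fin (n + 1) → G) × H) := {p | ∀ i : Fin (n + 1), p.1 ∘ i.succAbove ∈
      onFlags y n {x | (Fin.cons (p.2 : G) x : Fin (n + 1) → G) ∈ Q}} with hE
    have hEm : MeasurableSet E := by
      have h := measurableSet_onFlags hy (W := G) (Q := {p : G × (Fin n → G) |
        (Fin.cons (p.1 : G) p.2 : Fin (n + 1) → G) ∈ Q})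
        (measurable_cons measurable_fst measurable_snd hQ)
      have : E = ⋂ i : Fin (n + 1),
          (fun p : (Fin (n + 1) → G) × H => ((p.2 : G), p.1 ∘ i.succAbove)) ⁻¹'
          {p : G × (Fin n → G) | p.2 ∈ onFlags y n
            {x | (Fin.cons (p.1 : G) x : Fin (n + 1) → G) ∈ Q}} := by
        ext p
        simp [hE]
      rw [this]
      exact MeasurableSet.iInter fun i =>
        ((measurable_subtype_coe.comp measurable_snd).prodMk
          ((measurable_comp_succAbove i).comp measurable_fst)) h
    have hEpos : ∀ g, 2⁻¹ ≤ m (Prod.mk g ⁻¹' E) := by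
      intro g
      have h1 : m (Prod.mk g ⁻¹' E)ᶜ ≤ 2⁻¹ := by
        calc m (Prod.mk g ⁻¹' E)ᶜ
            ≤ m (⋃ i : Fin (n + 1), {z : H | g ∘ i.succAbove ∉ onFlags y n
              {x | (Fin.cons (z : G) x : Fin (n + 1) → G) ∈ Q}}) := by
              refine measure_mono fun z hz => ?_
              by_contra h'
              simp only [Set.mem_iUnion, not_exists, Set.mem_ofPred_eq, not_not] at h'
              exact hz h'
          _ ≤ ∑ i : Fin (n + 1), m {z : H | g ∘ i.succAbove ∉ onFlags y n
              {x | (Fin.cons (z : G) x : Fin (n + 1) → G) ∈ Q}} := measure_iUnion_fintype_le _ _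
          _ ≤ ∑ _i : Fin (n + 1), n.factorial * (2 * ((n + 1).factorial : ℝ≥0∞))⁻¹ :=
              Finset.sum_le_sum fun i _ => measure_notMem_onFlags_le y m
                (fun z : H => {x | (Fin.cons (z : G) x : Fin (n + 1) → G) ∈ Q}) (hyQ _)
          _ = 2⁻¹ := by
            rw [Finset.sum_const, Finset.card_univ, Fintype.card_fin, nsmul_eq_mul, ← mul_assoc]
            rw [ENNReal.mul_inv (by simp) (by simp), mul_comm (2⁻¹ : ℝ≥0∞), ← mul_assoc,
              ← Nat.cast_mul, ← Nat.factorial_succ, ENNReal.mul_inv_cancel, one_mul]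
            · exact_mod_cast (n + 1).factorial_ne_zero
            · simp
      have h2 : m (Prod.mk g ⁻¹' E) + m (Prod.mk g ⁻¹' E)ᶜ = 1 := by
        rw [measure_add_measure_compl (measurable_prodMk_left hEm), measure_univ]
      have h3 : m (Prod.mk g ⁻¹' E) = 1 - m (Prod.mk g ⁻¹' E)ᶜ :=
        ENNReal.eq_sub_of_add_eq (measure_ne_top _ _) h2
      rw [h3, ← ENNReal.one_sub_inv_two]
      exact tsub_le_tsub_left h1 1
    obtain ⟨s, hs, hsE⟩ := exists_measurable_selection m hEm (c := 2⁻¹) (by simp) hEpos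
    -- the selection is made equivariant by normalizing the first vertex
    set a : (Fin (n + 1) → G) → G := fun g =>
      r (g 0) * (s (((r (g 0) : G)⁻¹ * ·) ∘ g) : G) with ha
    have har : Measurable fun g : Fin (n + 1) → G => (r (g 0) : G) :=
      measurable_subtype_coe.comp (hr.comp (measurable_pi_apply 0))
    refine ⟨Function.update y n a, fun k => ?_, fun h hh k g => ?_, fun g i => ?_⟩
    · rcases eq_or_ne k n with rfl | hk
      · rw [Function.update_self]
        exact har.mul (measurable_subtype_coe.comp (hs.comp (measurable_pi_lambda _ fun i =>
          har.inv.mul (measurable_pi_apply i))))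
      · rw [Function.update_of_ne hk]
        exact hy k
    · rcases eq_or_ne k n with rfl | hk
      · rw [Function.update_self]
        have h1 : (r (h * g 0) : G) = h * r (g 0) := congrArg Subtype.val (hr' ⟨h, hh⟩ (g 0))
        simp only [ha, Function.comp_apply, h1, mul_assoc]
        congr 4
        funext i
        simp [mul_assoc]
      · rw [Function.update_of_ne hk]
        exact hyH h hh k g
    · rw [Function.update_self, onFlags_congr (y' := y)
        fun k hk => Function.update_of_ne hk.ne _ _]
      have h1 := hsE (((r (g 0) : G)⁻¹ * ·) ∘ g) i
      have h2 : g ∘ i.succAbove =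
          ((r (g 0) : G) * ·) ∘ (((r (g 0) : G)⁻¹ * ·) ∘ g) ∘ i.succAbove := by
        funext k
        simp
      rw [h2, comp_mem_onFlags y fun k g' => hyH _ (r (g 0)).2 k g']
      convert h1 using 2
      ext x
      simp only [ha, Set.mem_ofPred_eq]
      have h3 := hinv.mem_iff (r (g 0)).2
        (Fin.cons (s (((r (g 0) : G)⁻¹ * ·) ∘ g) : G) x)
      rwa [Fin.comp_cons] at h3

end apices

/-! ### Measurable cohomology of compact open subgroups -/

section vanishing

variable {G : Type*} [Group G] [TopologicalSpace G] [IsTopologicalGroup G] [MeasurableSpace G]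
  [BorelSpace G]

/-- An open subgroup is an equivariant measurable retract of the group. -/
lemma exists_measurable_retraction {H : Subgroup G} (hH : IsOpen (H : Set G)) :
    ∃ r : G → H, Measurable r ∧ ∀ (h : H) g, r (h * g) = h * r g := by
  set rep : G → G := fun g => (Quotient.mk (QuotientGroup.rightRel H) g).out with hrep
  have hrep' : ∀ (h : H) g, rep (h * g) = rep g := fun h g => by
    refine congrArg Quotient.out (Quotient.sound ?_)
    rw [← Quotient.eq_iff_equiv, Quotient.eq, QuotientGroup.rightRel_apply]
    simp
  have hmem : ∀ g, g * (rep g)⁻¹ ∈ H := fun g =>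
    QuotientGroup.rightRel_apply.1 (Quotient.mk_out (s := QuotientGroup.rightRel H) g)
  have hcont : Continuous rep := by
    refine IsLocallyConstant.continuous (IsLocallyConstant.iff_exists_open _ |>.2 fun g => ?_)
    refine ⟨(fun x => x * g⁻¹) ⁻¹' H, hH.preimage (continuous_mul_const _), by simp, fun x hx => ?_⟩
    have := hrep' ⟨_, hx⟩ g
    simpa using this
  refine ⟨fun g => ⟨g * (rep g)⁻¹, hmem g⟩, ?_, fun h g => ?_⟩
  · exact ((continuous_id.mul hcont.inv).subtype_mk _).measurable
  · ext
    simp only [hrep', Subgroup.coe_mul, mul_assoc]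

/-- A bounded equivariant cocycle of a compact group is the coboundary of its average over the
first vertex. -/
lemma exists_cob_eq_of_bounded {H : Subgroup G} (m : Measure H) [IsProbabilityMeasure m]
    [m.IsMulLeftInvariant] {n : ℕ} {β : (Fin (n + 1) → G) → ℝ} (hβ : Measurable β) {B : ℝ}
    (hB : ∀ g, |β g| ≤ B) {c : G → ℝ} (hc : ∀ h ∈ H, ∀ g, β ((h * ·) ∘ g) = c h * β g)
    (hcob : cob β = 0) :
    ∃ γ : (Fin n → G) → ℝ, Measurable γ ∧ (∀ h ∈ H, ∀ g, γ ((h * ·) ∘ g) = c h * γ g) ∧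
      cob γ = β := by
  have hjoint : Measurable fun p : (Fin n → G) × H => β (Fin.cons (p.2 : G) p.1) :=
    hβ.comp (measurable_cons (measurable_subtype_coe.comp measurable_snd) measurable_fst)
  have hint : ∀ g : Fin n → G, Integrable (fun h : H => β (Fin.cons (h : G) g)) m := fun g =>
    Integrable.of_bound (hjoint.comp measurable_prodMk_left).aestronglyMeasurable B
      (Filter.Eventually.of_forall fun h => hB _)
  refine ⟨fun g => ∫ h : H, β (Fin.cons (h : G) g) ∂m, ?_, fun h hh g => ?_, ?_⟩
  · exact (StronglyMeasurable.integral_prod_right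
      (f := fun (g : Fin n → G) (h : H) => β (Fin.cons (h : G) g))
      hjoint.stronglyMeasurable).measurable
  · change ∫ z : H, β (Fin.cons (z : G) ((h * ·) ∘ g)) ∂m = c h * ∫ z : H, β (Fin.cons (z : G) g) ∂m
    rw [← integral_mul_left_eq_self (μ := m) _ (⟨h, hh⟩ : H), ← integral_const_mul]
    refine integral_congr_ae (Filter.Eventually.of_forall fun z => ?_)
    change β (Fin.cons (h * (z : G)) ((h * ·) ∘ g)) = _
    rw [← Fin.comp_cons (h * ·) (z : G) g, hc h hh]
  · funext g
    have h1 : ∀ h : H, ∑ i : Fin (n + 1), (-1) ^ (i : ℕ) * β (Fin.cons (h : G) (g ∘ i.succAbove))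
        = β g := by
      intro h
      have h2 : atApex (h : G) (cob β) g = 0 := by rw [hcob]; rfl
      rw [atApex_cob] at h2
      exact (sub_eq_zero.1 h2).symm
    simp only [cob]
    calc _ = ∑ i : Fin (n + 1),
          ∫ h : H, (-1) ^ (i : ℕ) * β (Fin.cons (h : G) (g ∘ i.succAbove)) ∂m :=
        Finset.sum_congr rfl fun i _ => (integral_const_mul _ _).symm
      _ = ∫ h : H, β g ∂m := by
        rw [← integral_finsetSum _ fun i _ => (hint _).const_mul _]
        simp only [h1]
      _ = β g := by simp

variable [T2Space G] [SecondCountableTopology G]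

/-- Measurable real cocycles of a compact open subgroup `H`, in the complex of homogeneous cochains
of `G`, are coboundaries. A measurable cocycle need not be integrable, so that it cannot be
averaged over `H`; but its subdivision with generic apices is bounded. -/
theorem exists_cob_eq {H : Subgroup G} (hHc : IsCompact (H : Set G)) (hHo : IsOpen (H : Set G))
    {n : ℕ} {β : (Fin (n + 1) → G) → ℝ} (hβ : Measurable β) {c : G → ℝ}
    (hc : ∀ h ∈ H, |c h| = 1) (hβc : ∀ h ∈ H, ∀ g, β ((h * ·) ∘ g) = c h * β g)
    (hcob : cob β = 0) :
    ∃ γ : (Fin n → G) → ℝ, Measurable γ ∧ (∀ h ∈ H, ∀ g, γ ((h * ·) ∘ g) = c h * γ g) ∧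
      cob γ = β := by
  have : CompactSpace H := isCompact_iff_compactSpace.1 hHc
  have : PolishSpace H := by
    have : SecondCountableTopology H := inferInstanceAs (SecondCountableTopology (H : Set G))
    have := TopologicalSpace.metrizableSpace_of_t3_secondCountable H
    let := TopologicalSpace.metrizableSpaceMetric H
    infer_instance
  obtain ⟨r, hr, hr'⟩ := exists_measurable_retraction hHo
  set m : Measure H := Measure.haarMeasure ⊤ with hm
  have : IsProbabilityMeasure m := 
    ⟨by simpa using Measure.haarMeasure_self (K₀ := (⊤ : TopologicalSpace.PositiveCompacts H))⟩
  obtain ⟨N, hN⟩ := exists_isLarge m (Q := fun N : ℕ => {x | |β x| ≤ N})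
    (fun N => measurableSet_le hβ.abs measurable_const)
    (fun N M hNM x hx => le_trans (show |β x| ≤ N from hx) (Nat.cast_le.2 hNM))
    (fun x => exists_nat_ge |β x|)
  obtain ⟨y, hy, hyH, hyQ⟩ := exists_apex m hr hr' (measurableSet_le hβ.abs measurable_const)
    (fun h hh x hx => by
      simp only [Set.mem_ofPred_eq, hβc h hh, abs_mul, hc h hh, one_mul]
      exact hx) hN
  have hβs : ∀ h ∈ H, (fun x => β ((h * ·) ∘ x)) = c h • β := fun h hh => funext (hβc h hh)
  obtain ⟨γ, hγ, hγc, hγβ⟩ := exists_cob_eq_of_bounded m (β := subdiv y (n + 1) β) (c := c)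
    ((measurable_subdiv hy (F := fun p : G × (Fin (n + 1) → G) => β p.2)
      (hβ.comp measurable_snd)).comp (measurable_const (a := (1 : G)).prodMk measurable_id))
    (fun g => abs_subdiv_le y (fun x hx => hx) (hyQ g))
    (fun h hh g => by
      rw [subdiv_comp y (hyH h hh), hβs h hh, subdiv_smul]
      rfl)
    (by
      rw [← subdiv_cob, hcob]
      simpa using subdiv_smul y 0 (0 : (Fin (n + 2) → G) → ℝ))
  refine ⟨γ + subdivHtpy y n β, hγ.add ?_, fun h hh g => ?_, ?_⟩
  · exact (measurable_subdivHtpy hy (F := fun p : G × (Fin (n + 1) → G) => β p.2)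
      (hβ.comp measurable_snd)).comp (measurable_const (a := (1 : G)).prodMk measurable_id)
  · simp only [Pi.add_apply]
    rw [hγc h hh, subdivHtpy_comp y (hyH h hh), hβs h hh, subdivHtpy_smul, mul_add]
    rfl
  · have h1 := eq_subdiv_add_cob y hcob
    have h2 : cob (γ + subdivHtpy y n β) = cob γ + cob (subdivHtpy y n β) := by
      have := cob_sub (γ + subdivHtpy y n β) (subdivHtpy y n β)
      rw [add_sub_cancel_right] at this
      rw [this, sub_add_cancel]
    rw [h2, hγβ, ← h1]

end vanishing

open Set

namespace GCellComplex

universe u v w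

variable {G : Type v} [Group G] (K : GCellComplex.{u, v} G)

/-! ### The chain complex -/

section chainComplex

variable (A : Type w) [AddCommGroup A]

lemma groupD_succ_apply (β : K.Total A) (p : ℕ) (g : Fin (p + 2) → G) (σ : K.Cell) :
    K.groupD A β (p + 1) g σ = ∑ i : Fin (p + 2), (-1 : ℤ) ^ (i : ℕ) • β p (g ∘ i.succAbove) σ :=
  rfl

lemma bdry_apply (β : K.Total A) (p : ℕ) (g : Fin (p + 1) → G) (τ : K.Cell) :
    K.bdry A β p g τ = ∑ᶠ σ, K.inc σ τ • β p g σ := rfl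

lemma bdry_bdry {d : ℕ} (hd : ∀ σ, K.dim σ ≤ d) (β : K.Total A) : K.bdry A (K.bdry A β) = 0 :=
  (K.dual d hd 1).cobdry_cobdry A β

lemma groupD_bdry {d : ℕ} (hd : ∀ σ, K.dim σ ≤ d) (β : K.Total A) :
    K.groupD A (K.bdry A β) = K.bdry A (K.groupD A β) :=
  (K.dual d hd 1).groupD_cobdry A β

lemma chainD_chainD {d : ℕ} (hd : ∀ σ, K.dim σ ≤ d) {r s : ℤ} (h : s = r + 1) (β : K.Total A) :
    K.chainD A r (K.chainD A s β) = 0 := by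
  subst h
  simp only [chainD, AddMonoidHom.add_apply, AddMonoidHom.smul_apply, map_add, map_zsmul,
    groupD_groupD, K.bdry_bdry A hd, K.groupD_bdry A hd, Int.negOnePow_succ]
  simp

lemma bdry_eq_zero {β : K.Total A} {p : ℕ} {g : Fin (p + 1) → G} {τ : K.Cell}
    (h : ∀ σ, K.dim σ = K.dim τ + 1 → β p g σ = 0) : K.bdry A β p g τ = 0 := by
  refine finsum_eq_zero_of_forall_eq_zero fun σ => ?_
  by_contra hne
  have h1 := K.dim_of_inc σ τ fun h' => hne (by simp [h'])
  exact hne (by simp [h σ h1])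

lemma groupD_eq_zero {β : K.Total A} {p : ℕ} {g : Fin (p + 1) → G} {σ : K.Cell}
    (h : ∀ q x, p = q + 1 → β q x σ = 0) : K.groupD A β p g σ = 0 := by
  cases p with
  | zero => rfl
  | succ p =>
    rw [groupD_succ_apply]
    exact Finset.sum_eq_zero fun i _ => by rw [h p _ rfl, smul_zero]

variable [MeasurableSpace G] [MeasurableSpace A] [MeasurableAdd₂ A] [MeasurableNeg A]
variable {A} {χ : G →* ℤˣ}

lemma mem_dual_equivariant {d : ℕ} {hd : ∀ σ, K.dim σ ≤ d} {or : G →* ℤˣ} {β : K.Total A} :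
    β ∈ (K.dual d hd or).equivariant (χ * or) A ↔ β ∈ K.equivariant χ A := by
  refine ⟨fun h => ⟨h.1, fun p k g σ => (h.2 p k g σ).trans ?_⟩,
    fun h => K.dual_equivariant χ A d hd or h⟩
  change (χ k * or k * (or k * K.sgn k σ)) • β p g σ = _
  congr 1
  rcases Int.units_eq_one_or (or k) with h' | h' <;> simp [h']

lemma bdry_mem {d : ℕ} (hd : ∀ σ, K.dim σ ≤ d) {β : K.Total A} (hβ : β ∈ K.equivariant χ A) :
    K.bdry A β ∈ K.equivariant χ A :=
  (K.mem_dual_equivariant (hd := hd) (or := 1)).1 <|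
    (K.dual d hd 1).cobdry_mem ((K.mem_dual_equivariant (hd := hd) (or := 1)).2 hβ)

lemma chainD_mem {d : ℕ} (hd : ∀ σ, K.dim σ ≤ d) {r s : ℤ} (h : s = r + 1) {β : K.Total A}
    {L : Set K.Cell} (hβ : β ∈ K.chains χ A s L) : K.chainD A s β ∈ K.chains χ A r univ := by
  refine ⟨add_mem (K.bdry_mem hd hβ.1) (zsmul_mem (K.groupD_mem hβ.1) _), ?_⟩
  refine (K.supported A _).add_mem ?_ ((K.supported A _).zsmul_mem ?_ _)
  · intro p g τ hne
    by_contra hP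
    refine hne (K.bdry_eq_zero A fun σ hσ => ?_)
    by_contra h0
    have := (hβ.2 p g σ h0).1
    exact hP ⟨by omega, mem_univ _⟩
  · intro p g σ hne
    by_contra hP
    refine hne (K.groupD_eq_zero A fun q x hq => ?_)
    by_contra h0
    have := (hβ.2 q x σ h0).1
    exact hP ⟨by omega, mem_univ _⟩

lemma mem_chains_of_support {r : ℤ} {L L' : Set K.Cell} {β : K.Total A}
    (hβ : β ∈ K.chains χ A r L) (h : ∀ p g σ, β p g σ ≠ 0 → σ ∈ L') : β ∈ K.chains χ A r L' :=
  ⟨hβ.1, fun p g σ hne => ⟨(hβ.2 p g σ hne).1, h p g σ hne⟩⟩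

/-- The part of a chain on an invariant set of cells is a chain. -/
lemma restrict_mem_chains {r : ℤ} {L : Set K.Cell} {β : K.Total A} (hβ : β ∈ K.chains χ A r L)
    {S : Set K.Cell} [DecidablePred (· ∈ S)] (hS : ∀ (g : G) σ, g • σ ∈ S ↔ σ ∈ S) :
    (fun p g σ => if σ ∈ S then β p g σ else 0) ∈ K.chains χ A r (L ∩ S) := by
  refine ⟨⟨fun p σ => ?_, fun p h g σ => ?_⟩, fun p g σ hne => ?_⟩
  · by_cases hσ : σ ∈ S
    · simpa [hσ] using hβ.1.1 p σ
    · simp [hσ]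
  · simp only [hS]
    split_ifs
    · exact hβ.1.2 p h g σ
    · simp
  · have hσ : σ ∈ S := by
      by_contra hσ
      simp [hσ] at hne
    simp only [hσ, if_true] at hne
    exact ⟨(hβ.2 p g σ hne).1, (hβ.2 p g σ hne).2, hσ⟩

end chainComplex

/-! ### Comparison with the dual complex -/

section twist

variable (A : Type w) [AddCommGroup A]

/-- Multiplication by `(-1)^{d k}` on `k`-cells. It accounts for the difference between the signs
in the total boundary of `X` and in the total coboundary of the dual complex. -/
def twist (d : ℕ) : K.Total A →+ K.Total A where
  toFun β := fun p g σ => ((-1 : ℤˣ) ^ (d * K.dim σ)) • β p g σ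
  map_zero' := by
    funext p g σ
    simp
  map_add' a b := by
    funext p g σ
    simp

lemma twist_apply (d : ℕ) (β : K.Total A) (p : ℕ) (g : Fin (p + 1) → G) (σ : K.Cell) :
    K.twist A d β p g σ = ((-1 : ℤˣ) ^ (d * K.dim σ)) • β p g σ := rfl

lemma twist_twist (d : ℕ) (β : K.Total A) : K.twist A d (K.twist A d β) = β := by
  funext p g σ
  change ((-1 : ℤˣ) ^ (d * K.dim σ)) • ((-1 : ℤˣ) ^ (d * K.dim σ)) • β p g σ = _
  rw [smul_smul, Int.units_mul_self, one_smul]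

lemma twist_groupD (d : ℕ) (β : K.Total A) :
    K.twist A d (K.groupD A β) = K.groupD A (K.twist A d β) := by
  funext p g σ
  cases p with
  | zero => exact smul_zero _
  | succ p =>
    rw [twist_apply, groupD_succ_apply, groupD_succ_apply, Finset.smul_sum]
    exact Finset.sum_congr rfl fun i _ => smul_comm _ _ _

lemma twist_bdry (d : ℕ) (β : K.Total A) :
    K.twist A d (K.bdry A β) = ((-1 : ℤˣ) ^ d) • K.bdry A (K.twist A d β) := by
  funext p g τ
  change _ = ((-1 : ℤˣ) ^ d) • K.bdry A (K.twist A d β) p g τ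
  rw [twist_apply, bdry_apply, bdry_apply,
    smul_finsum' _ ((K.finite_cofaces τ).subset fun σ h hσ => h (by simp [hσ])),
    smul_finsum' _ ((K.finite_cofaces τ).subset fun σ h hσ => h (by simp [hσ]))]
  refine finsum_congr fun σ => ?_
  by_cases h : K.inc σ τ = 0
  · simp [h]
  · have h1 := K.dim_of_inc σ τ h
    rw [twist_apply, smul_comm (K.inc σ τ), smul_smul, ← pow_add, h1]
    congr 1
    rw [show d + d * (K.dim τ + 1) = d * K.dim τ + (d + d) by ring, pow_add _ (d * K.dim τ),
      Even.neg_one_pow ⟨d, rfl⟩, mul_one]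

/-- The twist carries the total coboundary of the dual complex to the total boundary. -/
lemma twist_dual_cochainD {d : ℕ} (hd : ∀ σ, K.dim σ ≤ d) (or : G →* ℤˣ) {r n : ℤ}
    (hr : Even r) (h : n = d - r) (β : K.Total A) :
    K.twist A d ((K.dual d hd or).cochainD A n β) = K.chainD A r (K.twist A d β) := by
  have h1 : n.negOnePow = (-1 : ℤˣ) ^ d := by
    rw [h, Int.negOnePow_sub, Int.negOnePow_even r hr, mul_one]
    rfl
  change K.twist A d (K.groupD A β + (n.negOnePow : ℤ) • K.bdry A β) = _
  rw [map_add, map_zsmul, twist_groupD, twist_bdry, ← Units.smul_def, smul_smul, h1,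
    Int.units_mul_self, one_smul, chainD, Int.negOnePow_even r hr]
  simp [add_comm]

lemma dual_skeletonLT_compl {d : ℕ} (hd : ∀ σ, K.dim σ ≤ d) (or : G →* ℤˣ) :
    ((K.dual d hd or).skeletonLT d)ᶜ = K.vertices := by
  ext σ
  have := hd σ
  change ¬ (d - K.dim σ < d) ↔ K.dim σ = 0
  omega

variable [MeasurableSpace G] [MeasurableSpace A] [MeasurableAdd₂ A] [MeasurableNeg A]
variable {A} {χ : G →* ℤˣ}

lemma twist_mem_chains (d : ℕ) {r : ℤ} {L : Set K.Cell} {β : K.Total A}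
    (hβ : β ∈ K.chains χ A r L) : K.twist A d β ∈ K.chains χ A r L := by
  refine ⟨⟨fun p σ => ?_, fun p h g σ => ?_⟩, fun p g σ hne => hβ.2 p g σ fun h0 => hne ?_⟩
  · exact measurable_zsmul' A (hβ.1.1 p σ) _
  · rw [twist_apply, twist_apply, K.dim_smul, hβ.1.2, smul_comm]
  · rw [twist_apply, h0, smul_zero]

lemma twist_of_vertices (d : ℕ) {r : ℤ} {β : K.Total A} (hβ : β ∈ K.chains χ A r K.vertices) :
    K.twist A d β = β := by
  funext p g σ
  change ((-1 : ℤˣ) ^ (d * K.dim σ)) • β p g σ = _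
  by_cases h : β p g σ = 0
  · rw [h, smul_zero]
  · rw [show K.dim σ = 0 from (hβ.2 p g σ h).2, mul_zero, pow_zero, one_smul]

/-- Cochains of the dual complex are the same as chains. -/
lemma mem_dual_cochains {d : ℕ} (hd : ∀ σ, K.dim σ ≤ d) {or : G →* ℤˣ} {r n : ℤ} (h : n = d - r)
    {L : Set K.Cell} {β : K.Total A} :
    β ∈ (K.dual d hd or).cochains (χ * or) A n L ↔ β ∈ K.chains χ A r L := by
  refine and_congr K.mem_dual_equivariant (forall_congr' fun p => forall_congr' fun g =>
    forall_congr' fun σ => imp_congr Iff.rfl (and_congr ?_ Iff.rfl))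
  have := hd σ
  change ((d - K.dim σ : ℕ) : ℤ) + p = n ↔ _
  omega

end twist

/-! ### Change of coefficients -/

section coefficients

variable {A B : Type*} [AddCommGroup A] [AddCommGroup B] (φ : A →+ B)

lemma mapCoeff_chainD (r : ℤ) (β : K.Total A) :
    K.mapCoeff φ (K.chainD A r β) = K.chainD B r (K.mapCoeff φ β) := by
  have h1 : K.mapCoeff φ (K.bdry A β) = K.bdry B (K.mapCoeff φ β) := by
    funext p g τ
    refine (AddMonoidHom.map_finsum φ ((K.finite_cofaces τ).subset
      fun σ h hσ => h (by simp [hσ]))).trans ?_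
    exact finsum_congr fun σ => map_zsmul φ _ _
  have h2 : K.mapCoeff φ (K.groupD A β) = K.groupD B (K.mapCoeff φ β) := by
    funext p g σ
    cases p with
    | zero => exact map_zero φ
    | succ p =>
      refine (map_sum φ (fun i : Fin (p + 2) => (-1 : ℤ) ^ (i : ℕ) • β p (g ∘ i.succAbove) σ)
        Finset.univ).trans ?_
      rw [groupD_succ_apply]
      exact Finset.sum_congr rfl fun i _ => map_zsmul φ _ _
  simp only [chainD, AddMonoidHom.add_apply, AddMonoidHom.smul_apply, map_add, map_zsmul, h1, h2]

/-- Reduction modulo `ℤ`. -/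
abbrev modOne : ℝ →+ UnitAddCircle := QuotientAddGroup.mk' (AddSubgroup.zmultiples (1 : ℝ))

lemma measurable_modOne : Measurable modOne := AddCircle.measurable_mk'

lemma mapCoeff_modOne_intCast (β : K.Total ℤ) :
    K.mapCoeff modOne (K.mapCoeff (Int.castAddHom ℝ) β) = 0 := by
  funext p g σ
  refine (QuotientAddGroup.eq_zero_iff _).2 (AddSubgroup.mem_zmultiples_iff.2 ⟨β p g σ, ?_⟩)
  exact (zsmul_eq_mul _ _).trans (mul_one _)

variable [MeasurableSpace G] [MeasurableSpace A] [MeasurableAdd₂ A] [MeasurableNeg A]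
  [MeasurableSpace B] [MeasurableAdd₂ B] [MeasurableNeg B] {χ : G →* ℤˣ}

variable {φ} in
lemma mapCoeff_mem (hφ : Measurable φ) {r : ℤ} {L : Set K.Cell} {β : K.Total A}
    (hβ : β ∈ K.chains χ A r L) : K.mapCoeff φ β ∈ K.chains χ B r L := by
  refine ⟨⟨fun p σ => hφ.comp (hβ.1.1 p σ), fun p h g σ => ?_⟩,
    fun p g σ hne => hβ.2 p g σ fun h0 => hne ?_⟩
  · refine (congrArg φ (hβ.1.2 p h g σ)).trans ?_
    rw [Units.smul_def, map_zsmul, ← Units.smul_def]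
    rfl
  · exact (congrArg φ h0).trans (map_zero φ)

lemma exists_int_lift {r : ℤ} {L : Set K.Cell} {x : K.Total ℝ} (hx : x ∈ K.chains χ ℝ r L)
    (h0 : K.mapCoeff modOne x = 0) :
    ∃ y ∈ K.chains χ ℤ r L, K.mapCoeff (Int.castAddHom ℝ) y = x := by
  have hfl : ∀ p g σ, ((⌊x p g σ⌋ : ℤ) : ℝ) = x p g σ := by
    intro p g σ
    have h1 : modOne (x p g σ) = 0 := congrFun (congrFun (congrFun h0 p) g) σ
    obtain ⟨k, hk⟩ := AddSubgroup.mem_zmultiples_iff.1 ((QuotientAddGroup.eq_zero_iff _).1 h1)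
    rw [← hk]
    simp
  refine ⟨fun p g σ => ⌊x p g σ⌋, ⟨⟨fun p σ => Int.measurable_floor.comp (hx.1.1 p σ),
    fun p h g σ => ?_⟩, fun p g σ hne => hx.2 p g σ fun h0 => hne (by simp [h0])⟩, ?_⟩
  · refine Int.cast_injective (α := ℝ) ?_
    rw [hfl, hx.1.2, Units.smul_def, Units.smul_def, smul_eq_mul, Int.cast_mul, hfl, zsmul_eq_mul]
  · funext p g σ
    exact hfl p g σ

/-- The representative in `[0, 1)` of an element of `ℝ/ℤ`. -/
noncomputable def fracPart (t : UnitAddCircle) : ℝ := (AddCircle.equivIco (1 : ℝ) 0 t : ℝ)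

lemma modOne_fracPart (t : UnitAddCircle) : modOne (fracPart t) = t :=
  (AddCircle.equivIco (1 : ℝ) 0).symm_apply_apply t

lemma fracPart_zero : fracPart 0 = 0 := by
  have h := AddCircle.coe_equivIco_mk_apply (p := (1 : ℝ)) 0
  simpa [fracPart] using h

lemma measurable_fracPart : Measurable fracPart :=
  measurable_subtype_coe.comp (AddCircle.measurableEquivIco (1 : ℝ) 0).measurable

lemma measurable_units_smul {W M : Type*} [MeasurableSpace W] [AddCommGroup M] [MeasurableSpace M]
    [MeasurableNeg M] {u : W → ℤˣ} {f : W → M} (hu : MeasurableSet {x | u x = 1})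
    (hf : Measurable f) : Measurable fun x => u x • f x := by
  classical
  have : (fun x => u x • f x) = fun x => if x ∈ {x | u x = 1} then f x else -f x := by
    funext x
    rcases Int.units_eq_one_or (u x) with h | h <;> simp [h]
  rw [this]
  exact Measurable.ite hu hf hf.neg

/-- Chains with coefficients in `ℝ/ℤ` lift to real chains. Since `fracPart` does not commute with
the sign action, it is applied after an element of the group has brought the first argument of
the cochain to `1`; `ε` is an orientation of the cells that the group preserves. -/
lemma exists_real_lift {ε : K.Cell → ℤˣ} (hε : ∀ (g : G) σ, ε (g • σ) = K.sgn g σ * ε σ)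
    (hχ : MeasurableSet {g | χ g = 1}) {r : ℤ} {L : Set K.Cell} {η : K.Total UnitAddCircle}
    (hη : η ∈ K.chains χ UnitAddCircle r L) :
    ∃ x ∈ K.chains χ ℝ r L, K.mapCoeff modOne x = η := by
  have hχ' : ∀ p, MeasurableSet {g : Fin (p + 1) → G | χ (g 0) = 1} := fun p =>
    measurable_pi_apply (X := fun _ : Fin (p + 1) => G) 0 hχ
  refine ⟨fun p g σ => χ (g 0) • ε σ • fracPart (χ (g 0) • ε σ • η p g σ),
    ⟨⟨fun p σ => ?_, fun p h g σ => ?_⟩, fun p g σ hne => hη.2 p g σ fun h0 => hne ?_⟩, ?_⟩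
  · exact measurable_units_smul (hχ' p) (measurable_units_smul (by simp)
      (measurable_fracPart.comp (measurable_units_smul (hχ' p)
        (measurable_units_smul (by simp) (hη.1.1 p σ)))))
  · simp only [hη.1.2, hε, map_mul, smul_smul]
    have h1 : χ h * χ (g 0) * (K.sgn h σ * ε σ * (χ h * K.sgn h σ)) = χ (g 0) * ε σ := by
      rcases Int.units_eq_one_or (χ h) with h' | h' <;>
      rcases Int.units_eq_one_or (K.sgn h σ) with h'' | h'' <;> simp [h', h'']
    have h2 : χ h * χ (g 0) * (K.sgn h σ * ε σ) = χ h * K.sgn h σ * (χ (g 0) * ε σ) :=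
      mul_mul_mul_comm _ _ _ _
    rw [h1, h2]
  · simp [h0, fracPart_zero]
  · funext p g σ
    change modOne (χ (g 0) • ε σ • fracPart (χ (g 0) • ε σ • η p g σ)) = _
    rw [Units.smul_def, Units.smul_def, map_zsmul, map_zsmul, modOne_fracPart,
      ← Units.smul_def, ← Units.smul_def]
    simp only [smul_smul]
    rw [← mul_assoc, Int.units_mul_self, one_smul]

end coefficients

/-! ### Vanishing of the real homology -/

section vanishing

variable (G) in
/-- A group element that carries the chosen point of the orbit of `x` to `x`. -/
lemma exists_smul_out {S : Type*} [MulAction G S] (x : S) :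
    ∃ g : G, g • (Quotient.mk (MulAction.orbitRel G S) x).out = x := by
  have h : MulAction.orbitRel G S _ x := Quotient.mk_out (s := MulAction.orbitRel G S) x
  exact (MulAction.orbitRel G S).symm h

/-- If no element of the group reverses the orientation of a cell, there is an orientation of all
the cells that the group preserves. -/
lemma exists_orientation (hK : ∀ (g : G) σ, g • σ = σ → K.sgn g σ = 1) :
    ∃ ε : K.Cell → ℤˣ, ∀ (g : G) σ, ε (g • σ) = K.sgn g σ * ε σ := by
  choose t ht using fun σ : K.Cell => exists_smul_out G σ
  refine ⟨fun σ => K.sgn (t σ) (Quotient.mk (MulAction.orbitRel G K.Cell) σ).out, fun g σ => ?_⟩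
  set σ₀ := (Quotient.mk (MulAction.orbitRel G K.Cell) σ).out with hσ₀
  have h0 : (Quotient.mk (MulAction.orbitRel G K.Cell) (g • σ)).out = σ₀ :=
    congrArg Quotient.out (Quotient.sound (MulAction.mem_orbit σ g))
  have h1 : t σ • σ₀ = σ := ht σ
  have h2 : t (g • σ) • σ₀ = g • σ := by
    have := ht (g • σ)
    rwa [h0] at this
  have h3 : ((g * t σ)⁻¹ * t (g • σ)) • σ₀ = σ₀ := by
    rw [mul_smul, h2, mul_inv_rev, mul_smul, inv_smul_smul, inv_smul_eq_iff, h1]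
  have h4 : t (g • σ) = g * t σ * ((g * t σ)⁻¹ * t (g • σ)) := by group
  change K.sgn (t (g • σ)) (Quotient.mk (MulAction.orbitRel G K.Cell) (g • σ)).out = _
  rw [h0, h4, K.sgn_mul, h3, hK _ _ h3, mul_one, K.sgn_mul, h1]

lemma groupD_eq_cob (β : K.Total ℝ) (p : ℕ) (g : Fin (p + 2) → G) (σ : K.Cell) :
    K.groupD ℝ β (p + 1) g σ = cob (fun x => β p x σ) g := by
  simp [groupD_succ_apply, cob, zsmul_eq_mul]

variable [TopologicalSpace G] [IsTopologicalGroup G] [T2Space G] [SecondCountableTopology G]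
  [MeasurableSpace G] [BorelSpace G] {χ : G →* ℤˣ}

/-- Equivariant cocycles with values in the real linear combinations of cells are coboundaries:
on each orbit, they are the cocycles of the stabilizer of a cell. -/
lemma exists_cob_eq_on_cells (hc : ∀ σ : K.Cell, IsCompact (MulAction.stabilizer G σ : Set G))
    (ho : ∀ σ : K.Cell, IsOpen (MulAction.stabilizer G σ : Set G)) {n : ℕ}
    {b : (Fin (n + 1) → G) → K.Cell → ℝ} (hb : ∀ σ, Measurable fun g => b g σ)
    (hbe : ∀ (h : G) g σ, b (fun i => h * g i) (h • σ) = (χ h * K.sgn h σ) • b g σ)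
    (hcob : ∀ σ, cob (fun g => b g σ) = 0) :
    ∃ c : (Fin n → G) → K.Cell → ℝ, (∀ σ, Measurable fun g => c g σ) ∧
      (∀ (h : G) g σ, c (fun i => h * g i) (h • σ) = (χ h * K.sgn h σ) • c g σ) ∧
      ∀ σ, cob (fun g => c g σ) = fun g => b g σ := by
  set s : G → K.Cell → ℝ := fun g σ => ((χ g * K.sgn g σ : ℤˣ) : ℤ) with hs
  have hbe' : ∀ (h : G) g σ, b ((h * ·) ∘ g) (h • σ) = s h σ * b g σ := fun h g σ => by
    refine (hbe h g σ).trans ?_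
    rw [Units.smul_def, zsmul_eq_mul]
  have hs1 : ∀ g σ, |s g σ| = 1 := fun g σ => by
    rcases Int.units_eq_one_or (χ g * K.sgn g σ) with h | h <;>
    · simp only [hs, h]
      simp
  have hsm : ∀ g h σ, s (g * h) σ = s g (h • σ) * s h σ := fun g h σ => by
    simp only [hs, map_mul, K.sgn_mul, ← Int.cast_mul, ← Units.val_mul]
    rw [mul_mul_mul_comm]
  choose γ hγ hγe hγb using fun σ => exists_cob_eq (hc σ) (ho σ) (hb σ) (c := fun h => s h σ)
    (fun h _ => hs1 h σ) (fun h hh g => by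
      have := hbe' h g σ
      rwa [MulAction.mem_stabilizer_iff.1 hh] at this) (hcob σ)
  choose t ht using fun σ : K.Cell => exists_smul_out G σ
  refine ⟨fun g σ => s (t σ) (Quotient.mk (MulAction.orbitRel G K.Cell) σ).out *
    γ (Quotient.mk (MulAction.orbitRel G K.Cell) σ).out (((t σ)⁻¹ * ·) ∘ g),
    fun σ => ?_, fun h g σ => ?_, fun σ => ?_⟩
  · exact ((hγ _).comp (measurable_pi_lambda _ fun i =>
      (measurable_pi_apply i).const_mul _)).const_mul _
  · set σ₀ := (Quotient.mk (MulAction.orbitRel G K.Cell) σ).out with hσ₀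
    have h0 : (Quotient.mk (MulAction.orbitRel G K.Cell) (h • σ)).out = σ₀ :=
      congrArg Quotient.out (Quotient.sound (MulAction.mem_orbit σ h))
    have h1 : t σ • σ₀ = σ := ht σ
    have h2 : t (h • σ) • σ₀ = h • σ := by
      have := ht (h • σ)
      rwa [h0] at this
    -- the two ways from `σ₀` to `h • σ` differ by an element `k` of the stabilizer
    obtain ⟨k, hk, hkt⟩ : ∃ k, k • σ₀ = σ₀ ∧ h * t σ = t (h • σ) * k :=
      ⟨(t (h • σ))⁻¹ * (h * t σ), by rw [mul_smul, mul_smul, h1, inv_smul_eq_iff, h2], by group⟩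
    have h3 : ((t (h • σ))⁻¹ * ·) ∘ (fun i => h * g i) = (k * ·) ∘ ((t σ)⁻¹ * ·) ∘ g := by
      funext i
      have : k = (t (h • σ))⁻¹ * (h * t σ) := by rw [hkt]; group
      simp only [Function.comp_apply, this]
      group
    have h4 : s h σ * s (t σ) σ₀ = s (t (h • σ)) σ₀ * s k σ₀ := by
      have h5 := hsm h (t σ) σ₀
      rw [hkt, hsm, h1, hk] at h5
      exact h5.symm
    have h6 : (χ h * K.sgn h σ) • (s (t σ) σ₀ * γ σ₀ (((t σ)⁻¹ * ·) ∘ g))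
        = s h σ * (s (t σ) σ₀ * γ σ₀ (((t σ)⁻¹ * ·) ∘ g)) := by
      rw [Units.smul_def, zsmul_eq_mul]
    change s (t (h • σ)) (Quotient.mk (MulAction.orbitRel G K.Cell) (h • σ)).out *
      γ (Quotient.mk (MulAction.orbitRel G K.Cell) (h • σ)).out
        (((t (h • σ))⁻¹ * ·) ∘ (fun i => h * g i))
      = (χ h * K.sgn h σ) • (s (t σ) σ₀ * γ σ₀ (((t σ)⁻¹ * ·) ∘ g))
    rw [h6, h0, h3, hγe σ₀ k hk, ← mul_assoc, ← mul_assoc, h4]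
  · funext g
    set σ₀ := (Quotient.mk (MulAction.orbitRel G K.Cell) σ).out with hσ₀
    have h1 : t σ • σ₀ = σ := ht σ
    have h2 := cob_smul (s (t σ) σ₀) fun x => γ σ₀ (((t σ)⁻¹ * ·) ∘ x)
    refine (congrFun h2 g).trans ?_
    change s (t σ) σ₀ * cob (γ σ₀) (((t σ)⁻¹ * ·) ∘ g) = b g σ
    rw [hγb, ← hbe', h1]
    congr 1
    funext i
    simp

/-- The equivariant homology with real coefficients vanishes in negative degrees. -/
theorem exists_chainD_eq {d : ℕ} (hd : ∀ σ, K.dim σ ≤ d)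
    (hc : ∀ σ : K.Cell, IsCompact (MulAction.stabilizer G σ : Set G))
    (ho : ∀ σ : K.Cell, IsOpen (MulAction.stabilizer G σ : Set G)) {r s : ℤ} (hs : s = r + 1)
    (hr : r < 0) :
    ∀ (k : ℕ) {w : K.Total ℝ} (_ : w ∈ K.chains χ ℝ r {σ | K.dim σ < k})
      (_ : K.chainD ℝ r w = 0), ∃ γ ∈ K.chains χ ℝ s univ, K.chainD ℝ s γ = w
  | 0, w, hw, _ => by
    refine ⟨0, zero_mem _, ?_⟩
    rw [map_zero]
    funext p g σ
    by_contra h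
    exact absurd (hw.2 p g σ (Ne.symm h)).2 (Nat.not_lt_zero _)
  | k + 1, w, hw, hD => by
    classical
    have hw0 : ∀ p g σ, k < K.dim σ → w p g σ = 0 := fun p g σ h => by
      by_contra hne
      have : K.dim σ < k + 1 := (hw.2 p g σ hne).2
      omega
    -- the part of `w` on the `k`-cells is a cocycle
    have hcoc : ∀ p σ, K.dim σ = k → cob (fun g => w p g σ) = 0 := by
      intro p σ hσ
      funext g
      have h1 := congrFun (congrFun (congrFun hD (p + 1)) g) σ
      have h2 : K.bdry ℝ w (p + 1) g σ = 0 := K.bdry_eq_zero ℝ fun τ hτ => hw0 _ _ _ (by omega)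
      change K.bdry ℝ w (p + 1) g σ + (r.negOnePow : ℤ) • K.groupD ℝ w (p + 1) g σ = 0 at h1
      rw [h2, zero_add, ← Units.smul_def, smul_eq_zero_iff_eq, groupD_eq_cob] at h1
      exact h1
    have hex : ∀ p : ℕ, ∃ c : (Fin (p + 1) → G) → K.Cell → ℝ, (∀ σ, Measurable fun g => c g σ) ∧
        (∀ (h : G) g σ, c (fun i => h * g i) (h • σ) = (χ h * K.sgn h σ) • c g σ) ∧
        ∀ σ, cob (fun g => c g σ) = fun g => if K.dim σ = k then w (p + 1) g σ else 0 := by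
      intro p
      refine K.exists_cob_eq_on_cells hc ho
        (b := fun g σ => if K.dim σ = k then w (p + 1) g σ else 0) (fun σ => ?_)
        (fun h g σ => ?_) (fun σ => ?_)
      · by_cases h : K.dim σ = k
        · simpa [h] using hw.1.1 (p + 1) σ
        · simp [h]
      · simp only [K.dim_smul]
        split_ifs
        · exact hw.1.2 (p + 1) h g σ
        · simp
      · by_cases h : K.dim σ = k
        · simpa [h] using hcoc (p + 1) σ h
        · simp only [h, if_false]
          exact cob_zero
    choose c hcm hce hcw using hex
    set γ : K.Total ℝ := fun p g σ => if K.dim σ = k ∧ (k : ℤ) - p = s then c p g σ else 0 with hγ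
    have hγmem : γ ∈ K.chains χ ℝ s univ := by
      refine ⟨⟨fun p σ => ?_, fun p h g σ => ?_⟩, fun p g σ hne => ?_⟩
      · by_cases h : K.dim σ = k ∧ (k : ℤ) - p = s
        · simpa [hγ, h] using hcm p σ
        · simp [hγ, h]
      · simp only [hγ, K.dim_smul]
        split_ifs
        · exact hce p h g σ
        · simp
      · by_cases h : K.dim σ = k ∧ (k : ℤ) - p = s
        · exact ⟨by rw [h.1]; exact h.2, mem_univ _⟩
        · exact absurd (by simp [hγ, h]) hne
    have hγ0 : ∀ p g σ, K.dim σ ≠ k → γ p g σ = 0 := fun p g σ h => by simp [hγ, h]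
    have hγw : ∀ p g σ, K.dim σ = k → K.groupD ℝ γ p g σ = w p g σ := by
      intro p g σ hσ
      have hdeg : w p g σ ≠ 0 → (k : ℤ) - p = r := fun h => by
        have := (hw.2 p g σ h).1
        rwa [hσ] at this
      cases p with
      | zero =>
        by_contra hne
        have := hdeg (Ne.symm hne)
        push_cast at this
        omega
      | succ p =>
        rw [groupD_eq_cob]
        by_cases hp : (k : ℤ) - p = s
        · have h1 : (fun x => γ p x σ) = fun x => c p x σ := by
            funext x
            simp [hγ, hσ, hp]
          rw [h1, hcw]
          simp [hσ]
        · have h1 : (fun x => γ p x σ) = 0 := by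
            funext x
            simp [hγ, hp]
          rw [h1, cob_zero]
          by_contra hne
          have := hdeg (Ne.symm hne)
          push_cast at this
          omega
    have hsgn : (s.negOnePow : ℤ) • K.chainD ℝ s γ
        = (s.negOnePow : ℤ) • K.bdry ℝ γ + K.groupD ℝ γ := by
      change (s.negOnePow : ℤ) • (K.bdry ℝ γ + (s.negOnePow : ℤ) • K.groupD ℝ γ) = _
      rw [smul_add, smul_smul, ← Units.val_mul, Int.units_mul_self, Units.val_one, one_smul]
    have hsub : w - (s.negOnePow : ℤ) • K.chainD ℝ s γ ∈ K.chains χ ℝ r {σ | K.dim σ < k} := by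
      refine K.mem_chains_of_support (sub_mem (VertexMap.chains_mono _ _ (subset_univ _) hw)
        (zsmul_mem (K.chainD_mem hd hs hγmem) _)) fun p g σ hne => ?_
      by_contra hσ
      have hσ : k ≤ K.dim σ := not_lt.1 hσ
      refine hne ?_
      have h1 : K.bdry ℝ γ p g σ = 0 := K.bdry_eq_zero ℝ fun τ hτ => hγ0 _ _ _ (by omega)
      rw [hsgn]
      change w p g σ - ((s.negOnePow : ℤ) • K.bdry ℝ γ p g σ + K.groupD ℝ γ p g σ) = 0
      rw [h1, smul_zero, zero_add]
      rcases hσ.eq_or_lt with h | h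
      · rw [hγw p g σ h.symm, sub_self]
      · rw [hw0 p g σ h, K.groupD_eq_zero ℝ fun q x _ => hγ0 q x σ h.ne', sub_self]
    obtain ⟨γ', hγ'mem, hγ'⟩ := exists_chainD_eq hd hc ho hs hr k hsub (by
      rw [map_sub, hD, map_zsmul, K.chainD_chainD ℝ hd hs, smul_zero, sub_zero])
    refine ⟨γ' + (s.negOnePow : ℤ) • γ, add_mem hγ'mem (zsmul_mem hγmem _), ?_⟩
    rw [map_add, map_zsmul, hγ', sub_add_cancel]

end vanishing

end GCellComplex

/-! ### Stabilizers of cells -/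

/-- By local finiteness, a group element close to the identity does not move a chosen point of an
open cell into the closure of another cell of the same dimension. -/
lemma OrientedGCellulation.isOpen_stabilizer {G : Type*} [Group G] [TopologicalSpace G]
    [IsTopologicalGroup G] {X : Type*} [TopologicalSpace X] [T2Space X]
    [CWComplex (univ : Set X)] [MulAction G X] [ContinuousSMul G X] {d : ℕ}
    (C : OrientedGCellulation G X d) (σ : C.toGCellComplex.Cell) :
    IsOpen (MulAction.stabilizer G σ : Set G) := by
  let σ' : Cells X := σ
  obtain ⟨x, hx⟩ := RelCWComplex.openCell_nonempty (C := (univ : Set X)) σ'.1 σ'.2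
  set F : Set X := ⋃ τ : {τ : Cells X // τ.1 = σ'.1 ∧ τ ≠ σ'}, Cells.closed τ.1 with hF
  have hclosed : IsClosed F := by
    refine LocallyFinite.isClosed_iUnion (C.locallyFinite.comp_injective Subtype.val_injective)
      fun τ => RelCWComplex.isClosed_closedCell
  have hxF : x ∉ F := by
    intro h
    obtain ⟨⟨τ, hτ, hne⟩, hxτ⟩ := mem_iUnion.1 h
    rcases (RelCWComplex.cellFrontier_union_openCell_eq_closedCell (C := (univ : Set X))
      τ.1 τ.2).symm.subset hxτ with h1 | h1
    · have h2 := RelCWComplex.cellFrontier_subset_skeletonLT τ.1 τ.2 h1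
      exact disjoint_left.1 (RelCWComplex.disjoint_skeletonLT_openCell (j := σ'.2)
        (by rw [hτ])) h2 hx
    · exact hne (OrientedGCellulation.eq_of_mem_opn h1 hx)
  refine Subgroup.isOpen_of_mem_nhds _ (g := 1) ?_
  have hnhds : (fun g : G => g • x) ⁻¹' Fᶜ ∈ 𝓝 (1 : G) :=
    (hclosed.isOpen_compl.preimage (continuous_id.smul continuous_const)).mem_nhds
      (by simpa using hxF)
  refine Filter.mem_of_superset hnhds fun g hg => ?_
  let := C.action
  change g • σ' = σ'
  by_contra hne
  refine hg (mem_iUnion.2 ⟨⟨g • σ', C.smul_dim g σ', hne⟩, ?_⟩)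
  refine RelCWComplex.openCell_subset_closedCell _ _ ?_
  exact (C.smul_opn g σ').symm.subset (mem_image_of_mem _ hx)

/-! ### Cancellation and boundaries -/

namespace GCellComplex

universe u v w

variable {G : Type v} [Group G] (K : GCellComplex.{u, v} G) [MeasurableSpace G]
variable {χ : G →* ℤˣ} {A : Type w} [AddCommGroup A] [MeasurableSpace A]
variable [MeasurableAdd₂ A] [MeasurableNeg A]

lemma homology_mk_eq_zero_iff {r : ℤ} {L : Set K.Cell} (c : K.cycles χ A r L) :
    (QuotientAddGroup.mk c : K.Homology χ A r L) = 0
      ↔ ∃ η ∈ K.chains χ A (r + 1) L, K.chainD A (r + 1) η = c :=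
  (QuotientAddGroup.eq_zero_iff _).trans (AddSubgroup.mem_addSubgroupOf.trans Iff.rfl)

variable {K} in
/-- For `z` an integral cycle on the vertices, some cocycle `ν` on the `(d - 1)`-skeleton of the
dual complex has an anomaly that cancels the dual of `z` if and only if `z` is a boundary: the
required chain with boundary `z` consists of a chain of vertices and of `-ν`. -/
lemma exists_connecting_add_eq_zero_iff {d : ℕ} (hd : ∀ σ, K.dim σ ≤ d) (or : G →* ℤˣ) {r s : ℤ}
    (hs : s = r + 1) (hse : Even s) {n m : ℤ} (hm : m = n + 1) (hmr : m = d - r)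
    (z : K.cycles χ A r K.vertices) :
    (∃ ν : (K.dual d hd or).cocyclesOn (χ * or) A n ((K.dual d hd or).skeletonLT d),
      (K.dual d hd or).connecting (χ * or) A n m hm _ ν
        + K.poincareLefschetz χ A d hd or r m hmr (QuotientAddGroup.mk z) = 0)
      ↔ ∃ y ∈ K.chains χ A s univ, K.chainD A s y = z := by
  classical
  have hns : n = d - s := by omega
  obtain rfl : n = m - 1 := by omega
  set Y := (K.dual d hd or).skeletonLT d with hY
  have hYc : Yᶜ = K.vertices := K.dual_skeletonLT_compl hd or
  set D : K.Total A →+ K.Total A := (K.dual d hd or).cochainD A (m - 1) with hD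
  have hDt : ∀ β : K.Total A, K.twist A d (D β) = K.chainD A s (K.twist A d β) :=
    K.twist_dual_cochainD A hd or hse hns
  have key : ∀ ν : (K.dual d hd or).cocyclesOn (χ * or) A (m - 1) Y,
      (K.dual d hd or).connecting (χ * or) A (m - 1) m hm _ ν
        + K.poincareLefschetz χ A d hd or r m hmr (QuotientAddGroup.mk z) = 0
      ↔ ∃ β ∈ (K.dual d hd or).cochains (χ * or) A (m - 1) Yᶜ, D β = D ν.1 + z.1 := fun ν =>
    (QuotientAddGroup.eq_zero_iff _).trans (AddSubgroup.mem_addSubgroupOf.trans Iff.rfl)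
  refine (exists_congr key).trans ?_
  constructor
  · have aux : ∀ ν β : K.Total A, ν ∈ K.chains χ A s univ → β ∈ K.chains χ A s univ →
        D β = D ν + z.1 → ∃ y ∈ K.chains χ A s univ, K.chainD A s y = z := by
      intro ν β hν hβ h
      refine ⟨K.twist A d (β - ν), K.twist_mem_chains d (sub_mem hβ hν), ?_⟩
      rw [← hDt, map_sub, h, add_sub_cancel_left, K.twist_of_vertices d z.2.1]
    rintro ⟨ν, β, hβ, h⟩
    exact aux ν.1 β
      (VertexMap.chains_mono _ _ (subset_univ _) ((K.mem_dual_cochains hd hns).1 ν.2.1))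
      (VertexMap.chains_mono _ _ (subset_univ _) ((K.mem_dual_cochains hd hns).1 hβ)) h
  · rintro ⟨y, hy, hyz⟩
    have hinv : ∀ (g : G) σ, g • σ ∈ K.vertices ↔ σ ∈ K.vertices := fun g σ => by
      change K.dim (g • σ) = 0 ↔ K.dim σ = 0
      rw [K.dim_smul]
    have ht := K.twist_mem_chains d hy
    set t := K.twist A d y with ht_def
    have hDz : D t = z := by
      have h2 := congrArg (K.twist A d) (hDt t)
      rw [ht_def, K.twist_twist A d y, hyz, ← ht_def] at h2
      rwa [K.twist_twist, K.twist_of_vertices d z.2.1] at h2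
    set β : K.Total A := fun p g σ => if σ ∈ K.vertices then t p g σ else 0 with hβ_def
    have hβ : β ∈ K.chains χ A s K.vertices := VertexMap.chains_mono _ _ inter_subset_right
      (K.restrict_mem_chains ht hinv)
    have hν : β - t ∈ K.chains χ A s Y := by
      refine K.mem_chains_of_support (sub_mem (VertexMap.chains_mono _ _ (subset_univ _) hβ) ht)
        fun p g σ hne => ?_
      by_contra hσ
      have hσ : σ ∈ K.vertices := hYc ▸ hσ
      refine hne ?_
      change β p g σ - t p g σ = 0
      simp [hβ_def, hσ]
    have hDβ : D β ∈ K.chains χ A r K.vertices := by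
      have h1 : D β = K.groupD A β := K.dual_cochainD_of_vertices χ A d hd or (m - 1) hβ
      have h2 := K.chainD_of_vertices χ A hβ
      rw [Int.negOnePow_even s hse, Units.val_one, one_smul] at h2
      rw [h1]
      refine K.mem_chains_of_support (h2 ▸ K.chainD_mem hd hs hβ) fun p g σ hne => ?_
      by_contra hσ
      refine hne (K.groupD_eq_zero A fun q x _ => ?_)
      by_contra hne'
      exact hσ (hβ.2 q x σ hne').2
    refine ⟨⟨β - t, (K.mem_dual_cochains hd hns).2 hν, ?_⟩, β,
      (K.mem_dual_cochains hd hns).2 (hYc.symm ▸ hβ), ?_⟩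
    · intro p g σ hne
      have h1 : D (β - t) = D β - z := by rw [map_sub, hDz]
      have h2 : D (β - t) ∈ K.chains χ A r K.vertices := h1 ▸ sub_mem hDβ z.2.1
      have h3 : σ ∈ Yᶜ := hYc.symm ▸ (h2.2 p g σ hne).2
      exact h3
    · change D β = D (β - t) + z
      rw [map_sub, hDz, sub_add_cancel]

end GCellComplex

end CrystalAnomaly

open CrystalAnomaly CrystalAnomaly.GCellComplex Set in
theorem theorem2 {G : Type*} [Group G] [TopologicalSpace G] [IsTopologicalGroup G] [T2Space G]
    [LocallyCompactSpace G] [SecondCountableTopology G] [MeasurableSpace G] [BorelSpace G]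
    (μ : G →* ℤˣ) (hμ : Continuous μ)
    {d : ℕ} {X : Type*} [TopologicalSpace X] [T2Space X]
    [ChartedSpace (EuclideanSpace ℝ (Fin d)) X]
    [MulAction G X] [ContinuousSMul G X] [Topology.CWComplex (Set.univ : Set X)]
    (C : CrystalAnomaly.OrientedGCellulation G X d)
    (hC : ∀ σ : C.toGCellComplex.Cell, IsCompact (MulAction.stabilizer G σ : Set G))
    {Λ : Type*} [MulAction G Λ] (f : CrystalAnomaly.Sites G Λ X) (a : CrystalAnomaly.AnomalousTexture μ Λ) :
    (∃ ν : CrystalAnomaly.DefectNetwork μ C, ν.Cancels f a) ↔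
      CrystalAnomaly.textureClass μ C f a = 0 := by
  set K := C.toGCellComplex with hK
  have hd : ∀ σ, K.dim σ ≤ d := C.dim_le
  obtain ⟨ε, hε⟩ := K.exists_orientation C.sgn_stabilizer
  have hμm : MeasurableSet {g | μ g = 1} :=
    ((isOpen_discrete ({1} : Set ℤˣ)).preimage hμ).measurableSet
  obtain ⟨a, rfl⟩ := QuotientAddGroup.mk_surjective a
  set ω₀ : K.Total UnitAddCircle := (C.vertexMap f).pushTotal UnitAddCircle a with hω₀
  have hω₀mem : ω₀ ∈ K.chains μ UnitAddCircle (-2) K.vertices :=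
    (C.vertexMap f).push_mem μ UnitAddCircle a.2.1
  have htex : textureClass μ C f (QuotientAddGroup.mk a) = 0
      ↔ ∃ η ∈ K.chains μ UnitAddCircle (-2 + 1) univ, K.chainD UnitAddCircle (-2 + 1) η = ω₀ :=
    K.homology_mk_eq_zero_iff _
  have hcancel := fun z : K.cycles μ ℤ (-3) K.vertices =>
    exists_connecting_add_eq_zero_iff (χ := μ) (A := ℤ) hd C.or (r := -3) (s := -2) (by norm_num)
      (by decide) (n := d + 2) (m := d + 3) (by ring) (by ring) z
  rw [htex]
  constructor
  · rintro ⟨ν, b, ⟨x, hx, ω, z, hxω, hxz, hω, rfl⟩, hνb⟩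
    obtain ⟨y, hy, hyz⟩ := (hcancel z).1 ⟨ν, hνb⟩
    -- the real cycle `x - y` represents the texture, and is a boundary
    obtain ⟨γ, hγ, hγD⟩ := K.exists_chainD_eq hd hC (fun σ => C.isOpen_stabilizer σ)
      (s := -2 + 1) (r := -2) rfl (by norm_num) (d + 1)
      (w := x - K.mapCoeff (Int.castAddHom ℝ) y)
      (VertexMap.chains_mono _ _ (fun σ _ => Nat.lt_succ_of_le (hd σ)) (sub_mem
        (VertexMap.chains_mono _ _ (subset_univ _) hx)
        (K.mapCoeff_mem (measurable_of_countable _) hy)))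
      (by rw [map_sub, hxz, ← K.mapCoeff_chainD, hyz, sub_self])
    have hωγ : K.chainD UnitAddCircle (-2 + 1) (K.mapCoeff modOne γ) = ω := by
      rw [← K.mapCoeff_chainD, hγD, map_sub, K.mapCoeff_modOne_intCast, sub_zero]
      exact hxω
    obtain ⟨η, hη, hηD⟩ := AddSubgroup.mem_addSubgroupOf.1 (QuotientAddGroup.eq.1 hω)
    refine ⟨K.mapCoeff modOne γ - η, sub_mem (K.mapCoeff_mem measurable_modOne hγ)
      (VertexMap.chains_mono _ _ (subset_univ _) hη), ?_⟩
    have hηD : K.chainD UnitAddCircle (-2 + 1) η = -ω₀ + ω := hηD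
    rw [map_sub, hωγ, hηD]
    abel
  · rintro ⟨η, hη, hηD⟩
    obtain ⟨η', hη', rfl⟩ := K.exists_real_lift hε hμm hη
    obtain ⟨x, hx, hxω⟩ := K.exists_real_lift hε hμm hω₀mem
    obtain ⟨y, hy, hyx⟩ := K.exists_int_lift (x := x - K.chainD ℝ (-2 + 1) η')
      (sub_mem (VertexMap.chains_mono _ _ (subset_univ _) hx) (K.chainD_mem hd rfl hη'))
      (by rw [map_sub, K.mapCoeff_chainD, hηD, hxω, sub_self])
    have hyD : K.mapCoeff (Int.castAddHom ℝ) (K.chainD ℤ (-2) y) = K.chainD ℝ (-2) x := by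
      rw [K.mapCoeff_chainD, hyx, map_sub, K.chainD_chainD ℝ hd rfl, sub_zero]
    have hz : K.chainD ℤ (-2) y ∈ K.cycles μ ℤ (-3) K.vertices := by
      refine ⟨K.mem_chains_of_support (K.chainD_mem hd (by norm_num) hy) fun p g σ hne => ?_,
        K.chainD_chainD ℤ hd (by norm_num) y⟩
      by_contra hσ
      have h1 : K.chainD ℝ (-2) x p g σ = 0 := by
        rw [K.chainD_of_vertices μ ℝ hx]
        change ((-2 : ℤ).negOnePow : ℤ) • K.groupD ℝ x p g σ = 0
        rw [K.groupD_eq_zero ℝ fun q x' _ => ?_, smul_zero]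
        by_contra hne'
        exact hσ (hx.2 q x' σ hne').2
      rw [← hyD] at h1
      exact hne (Int.cast_injective (α := ℝ) (h1.trans Int.cast_zero.symm))
    obtain ⟨ν, hν⟩ := (hcancel ⟨_, hz⟩).2 ⟨y, hy, rfl⟩
    refine ⟨ν, QuotientAddGroup.mk ⟨_, hz⟩, ⟨x, hx, ⟨ω₀, hω₀mem, ?_⟩, ⟨_, hz⟩, hxω, hyD.symm,
      rfl, rfl⟩, hν⟩
    exact ((C.vertexMap f).chainD_push μ UnitAddCircle a.2.1).trans
      ((congrArg _ a.2.2).trans (map_zero _))
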